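/- **Setting.** Let $L$ be the number of sites of a chain with Hilbert space $\mathcal H_C\otimes\mathcal H_Q=(\mathbb C^C)^{\otimes L}\otimes(\mathbb C^Q)^{\otimes L}$. A *standard-form Hamiltonian* is $H=H_{trans}+H_{pen}+H_{in}+H_{out}$, each part being $\sum_{i=1}^{L-1}h^{(i,i+1)}$ for a fixed two-site interaction, where * $h_{trans}$ is a sum of terms $\tfrac12(|cd\rangle\otimes U_{abcd}-|ab\rangle)(\langle cd|\otimes U_{abcd}^\dagger-\langle ab|)$, at most one for each two pairs $ab,cd$ of clock basis symbols, with $U_{abcd}$ unitary on $\mathbb C^Q\otimes\mathbb C^Q$ (the transition rule $ab\to cd$); * $h_{pen}=\sum_{ab\text{ illegal}}|ab\rangle\langle ab|\otimes 1$ for a set of illegal pairs; * $h_{in}=\sum_{ab}|ab\rangle\langle ab|\otimes\Pi_{ab}$ and $h_{out}=|xy\rangle\langle xy|\otimes\Pi_{xy}$, where $\Pi_{ab}$, $\Pi_{xy}$ are orthogonal projectors onto spans of standard basis states of $\mathbb C^Q\otimes\mathbb C^Q$. A standard basis state of $\mathcal H_C$ (a *clock state*) is *legal* if it contains no illegal pair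 on neighbouring sites, and illegal otherwise. The clock states are partitioned into minimal non-empty sets $S$ closed (in both directions) under the transition rules; $\mathcal K_S$ is the span of $S$, and $\lambda_0(\mathcal K_S)$ is the minimum eigenvalue of $H|_{\mathcal K_S\otimes\mathcal H_Q}$. Assume that the clock is a *standard-form clock* with initialisation time $T_{init}$: * there is a set $\mathcal W$ of clock states that contains all legal ones, is closed under the transition rules, and to each element of which at most one transition rule applies (at one place) in each direction; * every all-legal $S$ has a state without backwards transition and a state without forwards transition; so $S$ is a path, and we number its states $0,1,\dots,|S|-1$ along the transitions; * in every all-legal $S$: the transitions $t\to t+1$ with $t<T_{init}$ have trivial unitary; $h_{in}$ acts only on states with $t\le T_{init}$; and the pair $xy$ of $h_{out}$ occurs exactly once in the final state and in no other state of $S$; * in every $S$ that contains an illegal state, each legal state is at most $2L$ transitions, forwards or backwards, away from an illegal state. A *verifier* (on a fixed instance) consists of a non-zero space of correctly initialised inputs in $\mathcal H_Q$ (instance and blank work space fixed, witness arbitrary), a unitary on $\mathcal H_Q$ and an orthogonal projector onto the rejecting outcome. With error probability $\eta$, a *YES instance* is one where some normalised input is accepted with probability at least $1-\eta$, and a *NO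 instance* is one where every normalised input is accepted with probability at most $\eta$. Assume that $H$ *encodes* the verifier: for every all-legal $S$, the inputs are the $\psi\in\mathcal H_Q$ with $H_{in}(|t\rangle\otimes\psi)=0$ for all $t\in S$, the product of the unitaries along $S$ is the unitary of the verifier, and $H_{out}$ acts at the final clock state of $S$ as the rejecting projector. **QMA Clairvoyance Lemma.** Each $S$ falls into one of the following categories. 1. $S$ contains only illegal states, and $\lambda_0(\mathcal K_S)\ge 1$. 2. $S$ contains both legal and illegal states, and $\lambda_0(\mathcal K_S)\ge 1-\cos\left(\frac{\pi}{8L}\right)$. 3. $S$ contains only legal states. Then, with $T=|S|$ the number of time steps of the clock, $$0\le\lambda_0(\mathcal K_S)\le\eta^{1/2}\quad\text{for YES instances},$$ $$1-\cos\left(\frac{\pi}{2T}\right)-\eta^{1/2}\le\lambda_0(\mathcal K_S)\le 1-\cos\left(\frac{\pi}{2T}\right)\quad\text{for NO instances}.$$ -/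

import Mathlib

/-- Left and right site of the `i`-th nearest-neighbour pair of a chain of `L` sites. -/
def leftSite {L : ℕ} (i : Fin (L - 1)) : Fin L := ⟨i, by omega⟩

def rightSite {L : ℕ} (i : Fin (L - 1)) : Fin L := ⟨i + 1, by omega⟩

/-- The symbols of the product basis state `x` on the `i`-th nearest-neighbour pair. -/
def pairAt {L : ℕ} {A : Type*} (x : Fin L → A) (i : Fin (L - 1)) : A × A := (x (leftSite i), x (rightSite i))

/-- `x` and `y` agree on every site outside the `i`-th nearest-neighbour pair. -/
def AgreeOff {L : ℕ} {A : Type*} (i : Fin (L - 1)) (x y : Fin L → A) : Prop :=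
  ∀ j, j ≠ leftSite i → j ≠ rightSite i → x j = y j

/-- The operator `g ∈ B(ℂ^Q ⊗ ℂ^Q)` acting on the `i`-th pair of `(ℂ^Q)^{⊗L}`. -/
noncomputable def quantumTerm {L : ℕ} {Q : Type*} (i : Fin (L - 1))
    (g : Matrix (Q × Q) (Q × Q) ℂ) : Matrix (Fin L → Q) (Fin L → Q) ℂ :=
  open Classical in
  Matrix.of fun x y => if AgreeOff i x y then g (pairAt x i) (pairAt y i) else 0

/-- The operator `h ∈ B((ℂ^C ⊗ ℂ^Q)^{⊗2})` acting on the `i`-th pair of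
`(ℂ^C)^{⊗L} ⊗ (ℂ^Q)^{⊗L}`; the two clock symbols are listed before the two quantum symbols. -/
noncomputable def localTerm {L : ℕ} {C Q : Type*} (i : Fin (L - 1))
    (h : Matrix ((C × C) × (Q × Q)) ((C × C) × (Q × Q)) ℂ) :
    Matrix ((Fin L → C) × (Fin L → Q)) ((Fin L → C) × (Fin L → Q)) ℂ :=
  open Classical in
  Matrix.of fun x y =>
    if AgreeOff i x.1 y.1 ∧ AgreeOff i x.2 y.2 then
      h (pairAt x.1 i, pairAt x.2 i) (pairAt y.1 i, pairAt y.2 i)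
    else 0

/-- The data of the (translationally invariant, nearest-neighbour) interactions of a standard-form
Hamiltonian with clock symbols `C` and quantum symbols `Q`. -/
structure StandardForm (C Q : Type*) [Fintype Q] [DecidableEq Q] where
  /-- `trans ab cd = some U` if there is a transition rule `|ab⟩|ψ⟩ → |cd⟩ U|ψ⟩`,
  and `none` if there is no transition from `ab` to `cd`. -/
  trans : C × C → C × C → Option (Matrix.unitaryGroup (Q × Q) ℂ)
  /-- The illegal pairs. -/
  illegal : Set (C × C)
  /-- `Π_ab` projects onto the span of the basis states in `inPen ab`. -/
  inPen : C × C → Set (Q × Q)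
  /-- The clock pair `xy` on which the output penalty acts. -/
  outPair : C × C
  /-- `Π_xy` projects onto the span of the basis states in `outPen`. -/
  outPen : Set (Q × Q)

/-- A verification computation on a fixed instance, on a register with standard basis `n`. -/
structure Verifier (n : Type*) [Fintype n] [DecidableEq n] where
  /-- The space of correctly initialised inputs: the fixed instance and blank work space together
  with an arbitrary witness. -/
  inputs : Submodule ℂ (n → ℂ)
  inputs_ne_bot : inputs ≠ ⊥
  /-- The unitary performed by the whole computation. -/
  evolution : Matrix.unitaryGroup n ℂ
  /-- The orthogonal projector onto the rejecting outcome. -/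
  reject : Matrix n n ℂ
  reject_isHermitian : reject.IsHermitian
  reject_mul_self : reject * reject = reject

namespace Verifier

variable {n : Type*} [Fintype n] [DecidableEq n]

/-- The squared norm of a vector. -/
noncomputable def sqNorm (ψ : n → ℂ) : ℝ := ∑ q, ‖ψ q‖ ^ 2

/-- The probability that the verifier accepts the unit vector `ψ`. -/
noncomputable def acceptProb (V : Verifier n) (ψ : n → ℂ) : ℝ :=
  sqNorm ((1 - V.reject).mulVec ((V.evolution : Matrix n n ℂ).mulVec ψ))

/-- YES instance, with error probability at most `η`: some witness is accepted with probability at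
least `1 - η`. -/
def IsYes (V : Verifier n) (η : ℝ) : Prop :=
  ∃ ψ ∈ V.inputs, sqNorm ψ = 1 ∧ 1 - η ≤ V.acceptProb ψ

/-- NO instance, with error probability at most `η`: every witness is accepted with probability at
most `η`. -/
def IsNo (V : Verifier n) (η : ℝ) : Prop :=
  ∀ ψ ∈ V.inputs, sqNorm ψ = 1 → V.acceptProb ψ ≤ η

end Verifier

namespace StandardForm

variable {C Q : Type*} [Fintype C] [DecidableEq C] [Fintype Q] [DecidableEq Q]

/-- `|cd⟩ ⊗ U - |ab⟩ ⊗ 1`, as a map from `ℂ^Q ⊗ ℂ^Q` to `(ℂ^C)^{⊗2} ⊗ (ℂ^Q)^{⊗2}`. -/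
def ruleMap (ab cd : C × C) (U : Matrix (Q × Q) (Q × Q) ℂ) :
    Matrix ((C × C) × (Q × Q)) (Q × Q) ℂ :=
  Matrix.of fun s r =>
    (if s.1 = cd then U s.2 r else 0) - (if s.1 = ab then (1 : Matrix (Q × Q) (Q × Q) ℂ) s.2 r else 0)

/-- The term `(1/2) (|cd⟩ ⊗ U - |ab⟩) (⟨cd| ⊗ U† - ⟨ab|)` of a rule `ab → cd`. -/
noncomputable def ruleTerm (ab cd : C × C) (U : Matrix (Q × Q) (Q × Q) ℂ) :
    Matrix ((C × C) × (Q × Q)) ((C × C) × (Q × Q)) ℂ :=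
  (1 / 2 : ℂ) • (ruleMap ab cd U * (ruleMap ab cd U).conjTranspose)

noncomputable def hTrans (H : StandardForm C Q) :
    Matrix ((C × C) × (Q × Q)) ((C × C) × (Q × Q)) ℂ :=
  ∑ ab, ∑ cd,
    match H.trans ab cd with
    | some U => ruleTerm ab cd (U : Matrix (Q × Q) (Q × Q) ℂ)
    | none => 0

/-- `∑_{ab illegal} |ab⟩⟨ab| ⊗ 1`. -/
noncomputable def hPen (H : StandardForm C Q) :
    Matrix ((C × C) × (Q × Q)) ((C × C) × (Q × Q)) ℂ :=
  open Classical in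
  Matrix.diagonal fun s => if s.1 ∈ H.illegal then 1 else 0

/-- `∑_{ab} |ab⟩⟨ab| ⊗ Π_ab`. -/
noncomputable def hIn (H : StandardForm C Q) :
    Matrix ((C × C) × (Q × Q)) ((C × C) × (Q × Q)) ℂ :=
  open Classical in
  Matrix.diagonal fun s => if s.2 ∈ H.inPen s.1 then 1 else 0

/-- `|xy⟩⟨xy| ⊗ Π_xy`. -/
noncomputable def hOut (H : StandardForm C Q) :
    Matrix ((C × C) × (Q × Q)) ((C × C) × (Q × Q)) ℂ :=
  open Classical in
  Matrix.diagonal fun s => if s.1 = H.outPair ∧ s.2 ∈ H.outPen then 1 else 0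

noncomputable def HIn (H : StandardForm C Q) (L : ℕ) :
    Matrix ((Fin L → C) × (Fin L → Q)) ((Fin L → C) × (Fin L → Q)) ℂ :=
  ∑ i, localTerm i H.hIn

noncomputable def HOut (H : StandardForm C Q) (L : ℕ) :
    Matrix ((Fin L → C) × (Fin L → Q)) ((Fin L → C) × (Fin L → Q)) ℂ :=
  ∑ i, localTerm i H.hOut

noncomputable def HTrans (H : StandardForm C Q) (L : ℕ) :
    Matrix ((Fin L → C) × (Fin L → Q)) ((Fin L → C) × (Fin L → Q)) ℂ :=
  ∑ i, localTerm i H.hTrans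

noncomputable def HPen (H : StandardForm C Q) (L : ℕ) :
    Matrix ((Fin L → C) × (Fin L → Q)) ((Fin L → C) × (Fin L → Q)) ℂ :=
  ∑ i, localTerm i H.hPen

/-- The standard-form Hamiltonian `H_trans + H_pen + H_in + H_out` on a chain of `L` sites. -/
noncomputable def hamiltonian (H : StandardForm C Q) (L : ℕ) :
    Matrix ((Fin L → C) × (Fin L → Q)) ((Fin L → C) × (Fin L → Q)) ℂ :=
  H.HTrans L + H.HPen L + H.HIn L + H.HOut L

/-- `|k⟩ ⊗ ψ` for a standard basis state `k` of the clock register. -/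
def ket {L : ℕ} (k : Fin L → C) (ψ : (Fin L → Q) → ℂ) : (Fin L → C) × (Fin L → Q) → ℂ :=
  fun x => if x.1 = k then ψ x.2 else 0

/-- A standard basis state of the clock register is legal if it contains no illegal pair. -/
def Legal (H : StandardForm C Q) {L : ℕ} (k : Fin L → C) : Prop :=
  ∀ i, pairAt k i ∉ H.illegal

/-- One transition rule, applied somewhere on the chain, takes `k` to `k'`, and `G` is the
associated unitary on the quantum register. -/
def StepVia (H : StandardForm C Q) {L : ℕ} (k k' : Fin L → C)
    (G : Matrix (Fin L → Q) (Fin L → Q) ℂ) : Prop :=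
  ∃ i, ∃ U ∈ H.trans (pairAt k i) (pairAt k' i), AgreeOff i k k' ∧
    G = quantumTerm i (U : Matrix (Q × Q) (Q × Q) ℂ)

/-- `H.Evolves n k G k'`: `n` successive forward transitions take `k` to `k'`, and `G` is the
product of the associated unitaries (later ones to the left). -/
inductive Evolves (H : StandardForm C Q) {L : ℕ} (k : Fin L → C) :
    ℕ → Matrix (Fin L → Q) (Fin L → Q) ℂ → (Fin L → C) → Prop
  | refl : Evolves H k 0 1 k
  | step {n : ℕ} {F G : Matrix (Fin L → Q) (Fin L → Q) ℂ} {k' k'' : Fin L → C} :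
      Evolves H k n F k' → H.StepVia k' k'' G → Evolves H k (n + 1) (G * F) k''

/-- No backwards transition applies to `k`. -/
def IsInitial (H : StandardForm C Q) {L : ℕ} (k : Fin L → C) : Prop :=
  ∀ i ab, H.trans ab (pairAt k i) = none

/-- No forwards transition applies to `k`. -/
def IsFinal (H : StandardForm C Q) {L : ℕ} (k : Fin L → C) : Prop :=
  ∀ i cd, H.trans (pairAt k i) cd = none

/-- `S` is closed under the transition rules, in both directions. -/
def ClosedUnderRules (H : StandardForm C Q) {L : ℕ} (S : Set (Fin L → C)) : Prop :=
  ∀ k k' G, H.StepVia k k' G → (k ∈ S ↔ k' ∈ S)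

/-- `S` is a cell of the partition of the standard basis states of the clock register into minimal
(nonempty) sets closed under the transition rules. -/
def IsCell (H : StandardForm C Q) {L : ℕ} (S : Set (Fin L → C)) : Prop :=
  Minimal (fun S' => S'.Nonempty ∧ H.ClosedUnderRules S') S

/-- The eigenvalues of the restriction of the Hamiltonian to `K_S ⊗ H_Q`, where `K_S` is the span
of `S`. -/
def energies (H : StandardForm C Q) {L : ℕ} (S : Set (Fin L → C)) : Set ℝ :=
  {μ | ∃ v : (Fin L → C) × (Fin L → Q) → ℂ, v ≠ 0 ∧ (∀ x, x.1 ∉ S → v x = 0) ∧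
    (H.hamiltonian L).mulVec v = (μ : ℂ) • v}

/-- The transition rules and penalties form a standard-form clock on the chain of `L` sites, with
initialisation time `Tinit`. -/
structure IsStandardFormClock (H : StandardForm C Q) (L Tinit : ℕ) : Prop where
  /-- There is a set `W` of standard basis states of the clock register that contains all legal
  ones, is closed under the transition rules, and to each element of which at most one transition
  rule applies (at one place) in each direction. -/
  exists_wellFormed : ∃ W : Set (Fin L → C), (∀ k, H.Legal k → k ∈ W) ∧ H.ClosedUnderRules W ∧
    ∀ k ∈ W,
      {p : Fin (L - 1) × (C × C) | H.trans (pairAt k p.1) p.2 ≠ none}.Subsingleton ∧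
      {p : Fin (L - 1) × (C × C) | H.trans p.2 (pairAt k p.1) ≠ none}.Subsingleton
  /-- An all-legal cell has a state without backwards and a state without forwards transition. -/
  exists_ends : ∀ S : Set (Fin L → C), H.IsCell S → (∀ k ∈ S, H.Legal k) →
    (∃ k ∈ S, H.IsInitial k) ∧ ∃ k ∈ S, H.IsFinal k
  /-- In an all-legal cell the transitions `t → t + 1` with `t < Tinit` act trivially on the
  quantum register. -/
  init_trivial : ∀ S : Set (Fin L → C), H.IsCell S → (∀ k ∈ S, H.Legal k) →
    ∀ k₀ ∈ S, H.IsInitial k₀ → ∀ t F k, H.Evolves k₀ t F k → t < Tinit →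
      ∀ k' G, H.StepVia k k' G → G = 1
  /-- In an all-legal cell the input penalty acts on states `t` with `t ≤ Tinit` only. -/
  init_detected : ∀ S : Set (Fin L → C), H.IsCell S → (∀ k ∈ S, H.Legal k) →
    ∀ k₀ ∈ S, H.IsInitial k₀ → ∀ t F k, H.Evolves k₀ t F k →
      (∃ i, (H.inPen (pairAt k i)).Nonempty) → t ≤ Tinit
  /-- In an all-legal cell, `∑ᵢ |xy⟩⟨xy|` (on the `i`-th pair, `xy` being the pair of the output
  penalty) is the projector onto the final state. -/
  final_detected : ∀ S : Set (Fin L → C), H.IsCell S → (∀ k ∈ S, H.Legal k) → ∀ k ∈ S,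
    (H.IsFinal k → ∃! i, pairAt k i = H.outPair) ∧
    (¬ H.IsFinal k → ∀ i, pairAt k i ≠ H.outPair)
  /-- In a cell with an illegal state, every legal state is at most `2 L` transitions, forwards or
  backwards, away from an illegal state. -/
  rapid_illegal : ∀ S : Set (Fin L → C), H.IsCell S → (∃ k ∈ S, ¬ H.Legal k) →
    ∀ k ∈ S, H.Legal k → ∃ k', ¬ H.Legal k' ∧ ∃ n ≤ 2 * L, ∃ F,
      H.Evolves k n F k' ∨ H.Evolves k' n F k

/-- The Hamiltonian encodes the verification computation `V`: along every all-legal cell the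
states without input penalty are the inputs of `V`, the transitions from the initial to the final
clock state perform the unitary of `V`, and the output penalty at the final clock state is the
rejecting projector of `V`. -/
def Encodes (H : StandardForm C Q) {L : ℕ} (V : Verifier (Fin L → Q)) : Prop :=
  ∀ S : Set (Fin L → C), H.IsCell S → (∀ k ∈ S, H.Legal k) →
    (∀ ψ, ψ ∈ V.inputs ↔ ∀ k ∈ S, (H.HIn L).mulVec (ket k ψ) = 0) ∧
    (∀ k₀ ∈ S, ∀ k₁ ∈ S, H.IsInitial k₀ → H.IsFinal k₁ → ∀ t F, H.Evolves k₀ t F k₁ →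
      F = (V.evolution : Matrix (Fin L → Q) (Fin L → Q) ℂ)) ∧
    (∀ k₁ ∈ S, H.IsFinal k₁ → ∀ ψ,
      (H.HOut L).mulVec (ket k₁ ψ) = ket k₁ (V.reject.mulVec ψ))

end StandardForm

/-!
The expectation value of the Hamiltonian in `v = ∑ₖ |k⟩ ⊗ v_k` is a sum of `½ ‖v_{k'} - U v_k‖²` over
all transitions `k → k'` plus diagonal penalties (`dotProduct_hamiltonian_mulVec`). Up to unitaries
it is half of the Laplacian of the graph of transitions, plus a potential. By the variational
principle on `K_S ⊗ H_Q` (`exists_isLeast_energies`) it suffices to bound it from below for all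
states, and to find good trial states for the upper bounds.

Lower bounds come from positive supersolutions `w`: the inequality `le_norm_sub_sq`, with `r` the
ratio of the values of `w` at the ends of an edge, turns `(½ Δ + penalty) w ≥ c w` into the bound `c`
on the energy (`le_energy_of_weight`).

* If all states of `S` are illegal, the penalty alone is at least `1`.
* If `S` has legal and illegal states, each state has at most two neighbours and is at distance
  `d ≤ 2 L` from an illegal state. The weight `cos (θ (2 L - d + 1/2))` with `θ = π / (8 L)` satisfies
  the eigenvalue equation for `1 - cos θ` at legal states, and the penalty makes up for the kink at
  illegal ones (`le_energy_of_mixed`).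
* If `S` is all-legal, it is a path `f 0, …, f N` (`exists_isTimeline`). Undoing the unitaries along
  the path turns the transition terms into the Laplacian of the path, tensored with the identity. The
  input penalty is not affected, as it acts before any nontrivial unitary, and it remains diagonal in
  the standard basis. The trial states are the history state with constant amplitudes (YES) and with
  the amplitudes of the lowest mode of the path with a penalty at its end (NO); see
  `exists_historyState`.

  For the lower bound on a NO instance (`le_energy_of_isNo`) let `P` be the projector to the inputs,
  and `A` the projector to the states that the verifier accepts with certainty. As
  `‖A ψ‖² ≤ η ‖ψ‖²` on the range of `P`, one has `A + P ≤ 1 + √η` (`acceptProb_add_sqNorm_le`), so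
  the output penalty `1 - A` is at least `P - √η`. Since `P` is diagonal in the standard basis too,
  the problem decouples into one path per basis state `q` of the quantum register, with a unit
  penalty at the end if `q` is an input, and at some other vertex if it is not. A unit penalty
  anywhere on the path gives at least the energy `1 - cos (π / (2 (N + 1)))` of a penalty at the end
  (`le_sum_norm_sub_sq_add`).
-/

open StandardForm Verifier

/-! ### Sites and nearest-neighbour pairs -/

section Sites

variable {L : ℕ} {A : Type*}

/-- The configuration `x` with the symbols on the `i`-th nearest-neighbour pair replaced by `s`. -/
def splice (x : Fin L → A) (i : Fin (L - 1)) (s : A × A) : Fin L → A :=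
  Function.update (Function.update x (leftSite i) s.1) (rightSite i) s.2

lemma leftSite_ne_rightSite (i : Fin (L - 1)) : leftSite i ≠ rightSite i := by
  simp [leftSite, rightSite, Fin.ext_iff]

@[simp] lemma pairAt_splice (x : Fin L → A) (i : Fin (L - 1)) (s : A × A) :
    pairAt (splice x i s) i = s := by
  simp [pairAt, splice, Function.update_of_ne (leftSite_ne_rightSite i)]

lemma agreeOff_splice (x : Fin L → A) (i : Fin (L - 1)) (s : A × A) :
    AgreeOff i x (splice x i s) := by
  intro j h₁ h₂
  simp [splice, h₁, h₂]

lemma AgreeOff.eq_splice {i : Fin (L - 1)} {x y : Fin L → A} (h : AgreeOff i x y) :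
    splice x i (pairAt y i) = y := by
  funext j
  by_cases h₂ : j = rightSite i
  · subst h₂; simp [splice, pairAt]
  by_cases h₁ : j = leftSite i
  · subst h₁; simp [splice, pairAt, h₂]
  simp [splice, h₁, h₂, h j h₁ h₂]

lemma AgreeOff.refl (i : Fin (L - 1)) (x : Fin L → A) : AgreeOff i x x := fun _ _ _ => rfl

lemma AgreeOff.symm {i : Fin (L - 1)} {x y : Fin L → A} (h : AgreeOff i x y) : AgreeOff i y x :=
  fun j h₁ h₂ => (h j h₁ h₂).symm

lemma AgreeOff.trans {i : Fin (L - 1)} {x y z : Fin L → A} (h : AgreeOff i x y)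
    (h' : AgreeOff i y z) : AgreeOff i x z :=
  fun j h₁ h₂ => (h j h₁ h₂).trans (h' j h₁ h₂)

@[simp] lemma splice_pairAt (x : Fin L → A) (i : Fin (L - 1)) : splice x i (pairAt x i) = x :=
  (AgreeOff.refl i x).eq_splice

@[simp] lemma splice_splice_pairAt (x : Fin L → A) (i : Fin (L - 1)) (s : A × A) :
    splice (splice x i s) i (pairAt x i) = x :=
  (agreeOff_splice x i s).symm.eq_splice

lemma AgreeOff.eq_of_pairAt_eq {i : Fin (L - 1)} {x y : Fin L → A} (h : AgreeOff i x y)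
    (h' : pairAt x i = pairAt y i) : x = y := by
  rw [← h.eq_splice, ← h', splice_pairAt]

lemma sum_ite_agreeOff [Fintype A] {M : Type*} [AddCommMonoid M] (i : Fin (L - 1))
    (x : Fin L → A) [DecidablePred (AgreeOff i x)] (φ : (Fin L → A) → M) :
    ∑ y, (if AgreeOff i x y then φ y else 0) = ∑ s, φ (splice x i s) := by
  rw [← Finset.sum_filter]
  refine Finset.sum_nbij' (fun y => pairAt y i) (fun s => splice x i s) ?_ ?_ ?_ ?_ ?_
  · simp
  · simp [agreeOff_splice]
  · intro y hy; exact AgreeOff.eq_splice (by simpa using hy)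
  · simp
  · intro y hy
    simp only [Finset.mem_filter, Finset.mem_univ, true_and] at hy
    rw [hy.eq_splice]

/-- Exchanging the pair on the `i`-th place with a spare pair is an involution. It turns a sum over
the transitions leaving a state into a sum over the transitions arriving at it. -/
lemma sum_splice_comm [Fintype A] {M : Type*} [AddCommMonoid M] (i : Fin (L - 1))
    (φ : (Fin L → A) → A × A → M) :
    ∑ x, ∑ s, φ (splice x i s) (pairAt x i) = ∑ x, ∑ s, φ x s := by
  rw [← Fintype.sum_prod_type', ← Fintype.sum_prod_type']
  refine Finset.sum_nbij' (fun p => (splice p.1 i p.2, pairAt p.1 i))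
    (fun p => (splice p.1 i p.2, pairAt p.1 i)) ?_ ?_ ?_ ?_ ?_ <;> simp

end Sites

/-! ### Two-site operators on the quantum register -/

section QuantumTerm

variable {L : ℕ} {Q : Type*}

lemma quantumTerm_mulVec [Fintype Q] (i : Fin (L - 1)) (g : Matrix (Q × Q) (Q × Q) ℂ)
    (ψ : (Fin L → Q) → ℂ) (x : Fin L → Q) :
    (quantumTerm i g).mulVec ψ x = ∑ r, g (pairAt x i) r * ψ (splice x i r) := by
  classical
  simp only [Matrix.mulVec, dotProduct, quantumTerm, Matrix.of_apply, ite_mul, zero_mul]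
  rw [sum_ite_agreeOff]
  simp

lemma quantumTerm_conjTranspose (i : Fin (L - 1)) (g : Matrix (Q × Q) (Q × Q) ℂ) :
    (quantumTerm i g).conjTranspose = quantumTerm i g.conjTranspose := by
  ext x y
  simp only [quantumTerm, Matrix.conjTranspose_apply, Matrix.of_apply]
  by_cases h : AgreeOff i x y
  · rw [if_pos h, if_pos h.symm]
  · rw [if_neg h, if_neg fun h' => h h'.symm, star_zero]

lemma quantumTerm_mul [Fintype Q] (i : Fin (L - 1)) (g h : Matrix (Q × Q) (Q × Q) ℂ) :
    quantumTerm i g * quantumTerm i h = quantumTerm i (g * h) := by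
  classical
  ext x z
  simp only [Matrix.mul_apply, quantumTerm, Matrix.of_apply, ite_mul, zero_mul]
  rw [sum_ite_agreeOff]
  have key : ∀ s, AgreeOff i (splice x i s) z ↔ AgreeOff i x z := fun s =>
    ⟨(agreeOff_splice x i s).trans, (agreeOff_splice x i s).symm.trans⟩
  simp only [pairAt_splice, key]
  split_ifs <;> simp

lemma quantumTerm_one [DecidableEq Q] (i : Fin (L - 1)) :
    quantumTerm i (1 : Matrix (Q × Q) (Q × Q) ℂ) = 1 := by
  ext x y
  simp only [quantumTerm, Matrix.of_apply, Matrix.one_apply]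
  by_cases h : AgreeOff i x y
  · rw [if_pos h]
    by_cases h' : x = y
    · simp [h']
    · rw [if_neg h', if_neg fun h'' => h' (h.eq_of_pairAt_eq h'')]
  · rw [if_neg h, if_neg]
    rintro rfl
    exact h (AgreeOff.refl i x)

lemma quantumTerm_mem_unitaryGroup [Fintype Q] [DecidableEq Q] (i : Fin (L - 1))
    (U : Matrix.unitaryGroup (Q × Q) ℂ) :
    quantumTerm i (U : Matrix (Q × Q) (Q × Q) ℂ) ∈ Matrix.unitaryGroup (Fin L → Q) ℂ := by
  rw [Matrix.mem_unitaryGroup_iff, Matrix.star_eq_conjTranspose, quantumTerm_conjTranspose,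
    quantumTerm_mul, ← Matrix.star_eq_conjTranspose, Matrix.mem_unitaryGroup_iff.1 U.2,
    quantumTerm_one]

end QuantumTerm

/-! ### Two-site operators on clock and quantum register -/

section LocalTerm

variable {L : ℕ} {C Q : Type*}

/-- The component `v_k` of `v = ∑ₖ |k⟩ ⊗ v_k`. -/
def slice (v : (Fin L → C) × (Fin L → Q) → ℂ) (k : Fin L → C) : (Fin L → Q) → ℂ :=
  fun q => v (k, q)

lemma localTerm_mulVec [Fintype C] [Fintype Q] (i : Fin (L - 1))
    (h : Matrix ((C × C) × (Q × Q)) ((C × C) × (Q × Q)) ℂ)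
    (v : (Fin L → C) × (Fin L → Q) → ℂ) (k : Fin L → C) (q : Fin L → Q) :
    (localTerm i h).mulVec v (k, q) =
      ∑ s, ∑ r, h (pairAt k i, pairAt q i) (s, r) * v (splice k i s, splice q i r) := by
  classical
  simp only [Matrix.mulVec, dotProduct, localTerm, Matrix.of_apply, ite_mul, zero_mul, ite_and]
  rw [Fintype.sum_prod_type]
  have : ∀ x : Fin L → C, (∑ y : Fin L → Q, if AgreeOff i k x then
      if AgreeOff i q y then h (pairAt k i, pairAt q i) (pairAt x i, pairAt y i) * v (x, y) else 0
      else 0) = if AgreeOff i k x then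
        ∑ r, h (pairAt k i, pairAt q i) (pairAt x i, r) * v (x, splice q i r) else 0 := by
    intro x
    split_ifs
    · rw [sum_ite_agreeOff]; simp
    · simp
  rw [Finset.sum_congr rfl fun x _ => this x, sum_ite_agreeOff]
  simp

lemma localTerm_sum {ι : Type*} (s : Finset ι) (i : Fin (L - 1))
    (h : ι → Matrix ((C × C) × (Q × Q)) ((C × C) × (Q × Q)) ℂ) :
    localTerm i (∑ j ∈ s, h j) = ∑ j ∈ s, localTerm i (h j) := by
  ext x y
  simp only [localTerm, Matrix.of_apply, Matrix.sum_apply]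
  split_ifs <;> simp

lemma localTerm_zero (i : Fin (L - 1)) :
    localTerm i (0 : Matrix ((C × C) × (Q × Q)) ((C × C) × (Q × Q)) ℂ) = 0 := by
  ext x y
  simp [localTerm]

lemma localTerm_conjTranspose (i : Fin (L - 1))
    (h : Matrix ((C × C) × (Q × Q)) ((C × C) × (Q × Q)) ℂ) :
    (localTerm i h).conjTranspose = localTerm i h.conjTranspose := by
  ext x y
  simp only [localTerm, Matrix.conjTranspose_apply, Matrix.of_apply]
  by_cases h : AgreeOff i x.1 y.1 ∧ AgreeOff i x.2 y.2
  · rw [if_pos h, if_pos ⟨h.1.symm, h.2.symm⟩]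
  · rw [if_neg h, if_neg fun h' => h ⟨h'.1.symm, h'.2.symm⟩, star_zero]

lemma localTerm_diagonal [DecidableEq C] [DecidableEq Q] (i : Fin (L - 1))
    (d : (C × C) × (Q × Q) → ℂ) :
    localTerm i (Matrix.diagonal d) =
      Matrix.diagonal fun x => d (pairAt x.1 i, pairAt x.2 i) := by
  ext x y
  simp only [localTerm, Matrix.of_apply]
  by_cases hxy : x = y
  · subst hxy
    simp [AgreeOff.refl]
  · rw [Matrix.diagonal_apply_ne _ hxy]
    split_ifs with h
    · rw [Matrix.diagonal_apply_ne]
      intro h'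
      rw [Prod.mk.injEq] at h'
      exact hxy (Prod.ext (h.1.eq_of_pairAt_eq h'.1) (h.2.eq_of_pairAt_eq h'.2))
    · rfl

end LocalTerm

/-! ### Matrix elements of a transition rule -/

section Rules

variable {C Q : Type*} [DecidableEq C] [Fintype Q] [DecidableEq Q]

lemma ruleTerm_apply (ab cd : C × C) (U : Matrix.unitaryGroup (Q × Q) ℂ) (s s' : C × C)
    (r r' : Q × Q) :
    ruleTerm ab cd (U : Matrix (Q × Q) (Q × Q) ℂ) (s, r) (s', r') = (1 / 2) *
      ((if s = ab then
        (if s' = ab then (1 : Matrix (Q × Q) (Q × Q) ℂ) r r' else 0) -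
          (if s' = cd then (U : Matrix (Q × Q) (Q × Q) ℂ).conjTranspose r r' else 0) else 0) +
      (if s = cd then
        (if s' = cd then (1 : Matrix (Q × Q) (Q × Q) ℂ) r r' else 0) -
          (if s' = ab then (U : Matrix (Q × Q) (Q × Q) ℂ) r r' else 0) else 0)) := by
  have hU : ∑ x, (U : Matrix (Q × Q) (Q × Q) ℂ) r x *
      (starRingEnd ℂ) ((U : Matrix (Q × Q) (Q × Q) ℂ) r' x) =
      (1 : Matrix (Q × Q) (Q × Q) ℂ) r r' := by
    rw [← Matrix.mem_unitaryGroup_iff.1 U.2]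
    simp [Matrix.mul_apply]
  have h1 : ∀ x, (starRingEnd ℂ) ((1 : Matrix (Q × Q) (Q × Q) ℂ) r' x) =
      (1 : Matrix (Q × Q) (Q × Q) ℂ) x r' := by
    intro x
    simp only [Matrix.one_apply, eq_comm (a := r')]
    split_ifs <;> simp
  have h2 : ∀ f : Q × Q → ℂ, ∑ x, f x * (1 : Matrix (Q × Q) (Q × Q) ℂ) x r' = f r' := by
    intro f; simp [Matrix.one_apply]
  have h3 : ∀ f : Q × Q → ℂ, ∑ x, (1 : Matrix (Q × Q) (Q × Q) ℂ) r x * f x = f r := by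
    intro f; simp [Matrix.one_apply]
  simp only [ruleTerm, Matrix.smul_apply, Matrix.mul_apply, Matrix.conjTranspose_apply, ruleMap,
    Matrix.of_apply, smul_eq_mul, star_sub, RCLike.star_def]
  congr 1
  -- the pairs `ab` and `cd` may coincide, so that all sixteen cases occur
  rcases Classical.propComplete (s = ab) with e1 | e1 <;>
    rcases Classical.propComplete (s = cd) with e2 | e2 <;>
    rcases Classical.propComplete (s' = ab) with e3 | e3 <;>
    rcases Classical.propComplete (s' = cd) with e4 | e4 <;>
    simp only [e1, e2, e3, e4, if_true, if_false, sub_zero, zero_sub, zero_mul, mul_zero, map_zero,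
      neg_mul, mul_neg, neg_neg, Finset.sum_const_zero, h1, sub_mul, mul_sub,
      Finset.sum_sub_distrib, Finset.sum_neg_distrib, hU, h2, h3] <;> ring

end Rules

/-! ### Norms and unitaries -/

section SqNorm

variable {n : Type*} [Fintype n]

lemma ofReal_sqNorm (ψ : n → ℂ) : (sqNorm ψ : ℂ) = star ψ ⬝ᵥ ψ := by
  simp only [sqNorm, dotProduct, Complex.ofReal_sum, Pi.star_apply, RCLike.star_def]
  refine Finset.sum_congr rfl fun q _ => ?_
  rw [Complex.conj_mul']
  push_cast; rfl

lemma sqNorm_nonneg (ψ : n → ℂ) : 0 ≤ sqNorm ψ :=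
  Finset.sum_nonneg fun _ _ => sq_nonneg _

lemma sqNorm_eq_zero {ψ : n → ℂ} : sqNorm ψ = 0 ↔ ψ = 0 := by
  rw [sqNorm, Finset.sum_eq_zero_iff_of_nonneg fun _ _ => sq_nonneg _]
  simp [funext_iff]

lemma sqNorm_pos {ψ : n → ℂ} (h : ψ ≠ 0) : 0 < sqNorm ψ :=
  (sqNorm_nonneg ψ).lt_of_ne fun h' => h (sqNorm_eq_zero.1 h'.symm)

lemma sqNorm_smul (c : ℂ) (ψ : n → ℂ) : sqNorm (c • ψ) = ‖c‖ ^ 2 * sqNorm ψ := by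
  simp [sqNorm, mul_pow, Finset.mul_sum]

lemma star_mulVec_dotProduct (G : Matrix n n ℂ) (a b : n → ℂ) :
    star (G.mulVec a) ⬝ᵥ b = star a ⬝ᵥ G.conjTranspose.mulVec b := by
  rw [Matrix.star_mulVec, Matrix.dotProduct_mulVec]

variable [DecidableEq n]

lemma star_mulVec_dotProduct_mulVec {G : Matrix n n ℂ} (hG : G ∈ Matrix.unitaryGroup n ℂ)
    (a b : n → ℂ) : star (G.mulVec a) ⬝ᵥ G.mulVec b = star a ⬝ᵥ b := by
  rw [star_mulVec_dotProduct, Matrix.mulVec_mulVec, ← Matrix.star_eq_conjTranspose,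
    Matrix.mem_unitaryGroup_iff'.1 hG, Matrix.one_mulVec]

lemma sqNorm_mulVec {G : Matrix n n ℂ} (hG : G ∈ Matrix.unitaryGroup n ℂ) (a : n → ℂ) :
    sqNorm (G.mulVec a) = sqNorm a := by
  have : (sqNorm (G.mulVec a) : ℂ) = sqNorm a := by
    rw [ofReal_sqNorm, star_mulVec_dotProduct_mulVec hG, ofReal_sqNorm]
  exact_mod_cast this

lemma ofReal_sqNorm_sub_mulVec {G : Matrix n n ℂ} (hG : G ∈ Matrix.unitaryGroup n ℂ)
    (a b : n → ℂ) :
    (sqNorm (b - G.mulVec a) : ℂ) =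
      star a ⬝ᵥ (a - G.conjTranspose.mulVec b) + star b ⬝ᵥ (b - G.mulVec a) := by
  rw [ofReal_sqNorm, star_sub, sub_dotProduct, dotProduct_sub (star (G.mulVec a)),
    star_mulVec_dotProduct_mulVec hG, star_mulVec_dotProduct, dotProduct_sub (star a)]
  ring

end SqNorm

/-! ### Components along the clock states -/

section Slices

variable {L : ℕ} {C Q : Type*}

lemma slice_eq_zero {S : Set (Fin L → C)} {v : (Fin L → C) × (Fin L → Q) → ℂ}
    (hv : ∀ x, x.1 ∉ S → v x = 0) {k : Fin L → C} (hk : k ∉ S) : slice v k = 0 :=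
  funext fun q => hv (k, q) hk

variable [Fintype Q]

lemma sqNorm_slice_eq_zero {S : Set (Fin L → C)} {v : (Fin L → C) × (Fin L → Q) → ℂ}
    (hv : ∀ x, x.1 ∉ S → v x = 0) {k : Fin L → C} (hk : k ∉ S) : sqNorm (slice v k) = 0 :=
  sqNorm_eq_zero.2 (slice_eq_zero hv hk)

variable [Fintype C]

lemma star_dotProduct_eq_sum_slice (v w : (Fin L → C) × (Fin L → Q) → ℂ) :
    star v ⬝ᵥ w = ∑ k, star (slice v k) ⬝ᵥ slice w k := by
  simp [dotProduct, slice, Fintype.sum_prod_type]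

lemma sqNorm_eq_sum_slice (v : (Fin L → C) × (Fin L → Q) → ℂ) :
    sqNorm v = ∑ k, sqNorm (slice v k) := by
  simp [sqNorm, slice, Fintype.sum_prod_type]

end Slices

/-! ### The action of the transition terms -/

section Action

variable {L : ℕ} {C Q : Type*} [Fintype C] [DecidableEq C] [Fintype Q] [DecidableEq Q]

lemma slice_localTerm_ruleTerm_mulVec (i : Fin (L - 1)) (ab cd : C × C)
    (U : Matrix.unitaryGroup (Q × Q) ℂ) (v : (Fin L → C) × (Fin L → Q) → ℂ) (k : Fin L → C) :
    slice ((localTerm i (ruleTerm ab cd (U : Matrix (Q × Q) (Q × Q) ℂ))).mulVec v) k =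
      (1 / 2 : ℂ) •
        ((if pairAt k i = ab then
          slice v k - (quantumTerm i (U : Matrix (Q × Q) (Q × Q) ℂ)).conjTranspose.mulVec
            (slice v (splice k i cd)) else 0) +
        if pairAt k i = cd then
          slice v k - (quantumTerm i (U : Matrix (Q × Q) (Q × Q) ℂ)).mulVec
            (slice v (splice k i ab)) else 0) := by
  funext q
  have h1 : ∀ g : Matrix (Q × Q) (Q × Q) ℂ, ∀ s, ∑ x, g (pairAt q i) x *
      v (splice k i s, splice q i x) = (quantumTerm i g).mulVec (slice v (splice k i s)) q := by
    intro g s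
    rw [quantumTerm_mulVec]; rfl
  simp only [slice, localTerm_mulVec, ruleTerm_apply, Pi.smul_apply, Pi.add_apply, smul_eq_mul,
    mul_assoc, ← Finset.mul_sum, add_mul, Finset.sum_add_distrib, quantumTerm_conjTranspose]
  congr 2
  · split_ifs with h
    · simp only [sub_mul, ite_mul, zero_mul, Finset.sum_sub_distrib]
      rw [Finset.sum_comm, Finset.sum_comm (γ := C × C)]
      simp only [Finset.sum_ite_eq', Finset.mem_univ, if_true, h1]
      subst h
      simp [quantumTerm_one, slice]
    · simp
  · split_ifs with h
    · simp only [sub_mul, ite_mul, zero_mul, Finset.sum_sub_distrib]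
      rw [Finset.sum_comm, Finset.sum_comm (γ := C × C)]
      simp only [Finset.sum_ite_eq', Finset.mem_univ, if_true, h1]
      subst h
      simp [quantumTerm_one, slice]
    · simp

/-- The action of the transition terms at one place: a state `k` is coupled to the successors and
to the predecessors of `k`. -/
lemma slice_localTerm_hTrans_mulVec (H : StandardForm C Q) (i : Fin (L - 1))
    (v : (Fin L → C) × (Fin L → Q) → ℂ) (k : Fin L → C) :
    slice ((localTerm i H.hTrans).mulVec v) k =
      (1 / 2 : ℂ) •
        ((∑ cd, (H.trans (pairAt k i) cd).elim 0 fun U =>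
          slice v k - (quantumTerm i (U : Matrix (Q × Q) (Q × Q) ℂ)).conjTranspose.mulVec
            (slice v (splice k i cd))) +
        ∑ ab, (H.trans ab (pairAt k i)).elim 0 fun U =>
          slice v k - (quantumTerm i (U : Matrix (Q × Q) (Q × Q) ℂ)).mulVec
            (slice v (splice k i ab))) := by
  have hH : H.hTrans = ∑ ab, ∑ cd, (H.trans ab cd).elim 0 fun U =>
      ruleTerm ab cd (U : Matrix (Q × Q) (Q × Q) ℂ) := by
    refine Finset.sum_congr rfl fun ab _ => Finset.sum_congr rfl fun cd _ => ?_
    cases H.trans ab cd <;> rfl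
  have key : ∀ ab cd, slice ((localTerm i ((H.trans ab cd).elim 0 fun U =>
      ruleTerm ab cd (U : Matrix (Q × Q) (Q × Q) ℂ))).mulVec v) k = (1 / 2 : ℂ) •
        ((if ab = pairAt k i then (H.trans ab cd).elim 0 fun U =>
          slice v k - (quantumTerm i (U : Matrix (Q × Q) (Q × Q) ℂ)).conjTranspose.mulVec
            (slice v (splice k i cd)) else 0) +
        if cd = pairAt k i then (H.trans ab cd).elim 0 fun U =>
          slice v k - (quantumTerm i (U : Matrix (Q × Q) (Q × Q) ℂ)).mulVec
            (slice v (splice k i ab)) else 0) := by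
    intro ab cd
    cases H.trans ab cd with
    | none => funext q; simp [localTerm_zero, slice]
    | some U =>
      simp only [slice_localTerm_ruleTerm_mulVec, Option.elim_some, eq_comm (b := pairAt k i)]
  have hs : ∀ (f : C × C → C × C → (Fin L → C) × (Fin L → Q) → ℂ),
      slice (∑ ab, ∑ cd, f ab cd) k = ∑ ab, ∑ cd, slice (f ab cd) k := by
    intro f
    funext q
    simp [slice]
  rw [hH, localTerm_sum]
  simp only [localTerm_sum, Matrix.sum_mulVec, hs, key, ← Finset.smul_sum, Finset.sum_add_distrib]
  congr 2
  · rw [Finset.sum_comm]; simp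
  · simp

/-- The expectation value of the transition terms is a sum over all transitions `k → k'`. -/
lemma dotProduct_HTrans_mulVec (H : StandardForm C Q) (v : (Fin L → C) × (Fin L → Q) → ℂ) :
    star v ⬝ᵥ (H.HTrans L).mulVec v =
      ((∑ i, ∑ k, ∑ cd, (H.trans (pairAt k i) cd).elim 0 fun U => 1 / 2 * sqNorm
        (slice v (splice k i cd) -
          (quantumTerm i (U : Matrix (Q × Q) (Q × Q) ℂ)).mulVec (slice v k)) : ℝ) : ℂ) := by
  rw [HTrans, Matrix.sum_mulVec, dotProduct_sum, Complex.ofReal_sum]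
  refine Finset.sum_congr rfl fun i _ => ?_
  rw [star_dotProduct_eq_sum_slice]
  simp only [slice_localTerm_hTrans_mulVec, dotProduct_smul, dotProduct_add, dotProduct_sum,
    smul_eq_mul, ← Finset.mul_sum, Finset.sum_add_distrib]
  rw [← sum_splice_comm i fun k ab => star (slice v k) ⬝ᵥ (H.trans ab (pairAt k i)).elim 0 fun U =>
    slice v k - (quantumTerm i (U : Matrix (Q × Q) (Q × Q) ℂ)).mulVec (slice v (splice k i ab))]
  simp only [pairAt_splice, splice_splice_pairAt, ← Finset.sum_add_distrib, Finset.mul_sum,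
    Complex.ofReal_sum]
  refine Finset.sum_congr rfl fun k _ => Finset.sum_congr rfl fun cd _ => ?_
  cases H.trans (pairAt k i) cd with
  | none => simp
  | some U =>
    simp only [Option.elim_some]
    push_cast
    rw [ofReal_sqNorm_sub_mulVec (quantumTerm_mem_unitaryGroup i U)]

end Action

/-! ### The least eigenvalue of a Hermitian matrix -/

section LeastEigenvalue

lemma mulVec_diagonal_expectation {n : Type*} [Fintype n] [DecidableEq n] (d : n → ℝ)
    (v : n → ℂ) :
    star v ⬝ᵥ (Matrix.diagonal fun x => (d x : ℂ)).mulVec v =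
      ((∑ x, d x * ‖v x‖ ^ 2 : ℝ) : ℂ) := by
  simp only [dotProduct, Matrix.mulVec_diagonal, Pi.star_apply, RCLike.star_def,
    Complex.ofReal_sum]
  refine Finset.sum_congr rfl fun x _ => ?_
  push_cast
  rw [← Complex.conj_mul']
  ring

/-- The Rayleigh principle: the least eigenvalue of a Hermitian matrix exists and bounds the
expectation value from below. -/
lemma Matrix.IsHermitian.exists_least_eigenvalue {n : Type*} [Fintype n] [DecidableEq n]
    [Nonempty n] {M : Matrix n n ℂ} (hM : M.IsHermitian) :
    ∃ lam : ℝ, (∃ v : n → ℂ, v ≠ 0 ∧ M.mulVec v = (lam : ℂ) • v) ∧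
      ∀ v : n → ℂ, lam * sqNorm v ≤ (star v ⬝ᵥ M.mulVec v).re := by
  obtain ⟨j, -, hj⟩ := Finset.exists_min_image Finset.univ hM.eigenvalues Finset.univ_nonempty
  refine ⟨hM.eigenvalues j, ⟨(hM.eigenvectorBasis j).ofLp, ?_, ?_⟩, fun v => ?_⟩
  · intro h
    have := hM.eigenvectorBasis.orthonormal.ne_zero j
    exact this (by ext x; simpa using congrFun h x)
  · rw [hM.mulVec_eigenvectorBasis]
    ext x
    simp
  · set U : Matrix n n ℂ := (hM.eigenvectorUnitary : Matrix n n ℂ) with hU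
    have hU' : star U ∈ Matrix.unitaryGroup n ℂ := (star hM.eigenvectorUnitary).2
    have hM' : M = U * Matrix.diagonal (fun x => (hM.eigenvalues x : ℂ)) * star U := by
      conv_lhs => rw [hM.spectral_theorem, Unitary.conjStarAlgAut_apply]
      rfl
    have : star v ⬝ᵥ M.mulVec v = star ((star U).mulVec v) ⬝ᵥ
        (Matrix.diagonal fun x => (hM.eigenvalues x : ℂ)).mulVec ((star U).mulVec v) := by
      conv_lhs => rw [hM', ← Matrix.mulVec_mulVec, ← Matrix.mulVec_mulVec]
      rw [star_mulVec_dotProduct, ← Matrix.star_eq_conjTranspose, star_star]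
    rw [this, mulVec_diagonal_expectation, Complex.ofReal_re, ← sqNorm_mulVec hU' v, sqNorm,
      Finset.mul_sum]
    exact Finset.sum_le_sum fun x _ =>
      mul_le_mul_of_nonneg_right (hj x (Finset.mem_univ x)) (sq_nonneg _)

end LeastEigenvalue

namespace StandardForm

/-! ### The penalty terms -/

section Penalties

variable {L : ℕ} {C Q : Type*} [Fintype Q] [DecidableEq Q]

open Classical in
/-- The number of illegal pairs in the clock state `k`. -/
noncomputable def penCount (H : StandardForm C Q) (k : Fin L → C) : ℝ :=
  ∑ i, if pairAt k i ∈ H.illegal then 1 else 0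

open Classical in
/-- The number of places at which the input penalty is violated by the basis state `k, q`. -/
noncomputable def inCount (H : StandardForm C Q) (k : Fin L → C) (q : Fin L → Q) : ℝ :=
  ∑ i, if pairAt q i ∈ H.inPen (pairAt k i) then 1 else 0

open Classical in
/-- The number of places at which the output penalty is violated by the basis state `k, q`. -/
noncomputable def outCount (H : StandardForm C Q) (k : Fin L → C) (q : Fin L → Q) : ℝ :=
  ∑ i, if pairAt k i = H.outPair ∧ pairAt q i ∈ H.outPen then 1 else 0

variable (H : StandardForm C Q) (k : Fin L → C) (q : Fin L → Q)

lemma penCount_nonneg : 0 ≤ H.penCount k :=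
  Finset.sum_nonneg fun _ _ => by split_ifs <;> norm_num

lemma inCount_nonneg : 0 ≤ H.inCount k q :=
  Finset.sum_nonneg fun _ _ => by split_ifs <;> norm_num

lemma outCount_nonneg : 0 ≤ H.outCount k q :=
  Finset.sum_nonneg fun _ _ => by split_ifs <;> norm_num

variable {H k q}

lemma one_le_penCount (h : ¬ H.Legal k) : 1 ≤ H.penCount k := by
  classical
  obtain ⟨i, hi⟩ : ∃ i, pairAt k i ∈ H.illegal := by
    by_contra! h'
    exact h h'
  calc (1 : ℝ) = if pairAt k i ∈ H.illegal then 1 else 0 := by rw [if_pos hi]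
    _ ≤ _ := Finset.single_le_sum (f := fun i => if pairAt k i ∈ H.illegal then (1 : ℝ) else 0)
      (fun _ _ => by split_ifs <;> norm_num) (Finset.mem_univ i)

lemma penCount_eq_zero (h : H.Legal k) : H.penCount k = 0 :=
  Finset.sum_eq_zero fun i _ => if_neg (h i)

lemma exists_mem_inPen (h : H.inCount k q ≠ 0) : ∃ i, pairAt q i ∈ H.inPen (pairAt k i) := by
  by_contra! h'
  exact h (Finset.sum_eq_zero fun i _ => if_neg (h' i))

lemma one_le_inCount (h : H.inCount k q ≠ 0) : 1 ≤ H.inCount k q := by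
  classical
  obtain ⟨i, hi⟩ := exists_mem_inPen h
  calc (1 : ℝ) = if pairAt q i ∈ H.inPen (pairAt k i) then 1 else 0 := by rw [if_pos hi]
    _ ≤ _ := Finset.single_le_sum
      (f := fun i => if pairAt q i ∈ H.inPen (pairAt k i) then (1 : ℝ) else 0)
      (fun _ _ => by split_ifs <;> norm_num) (Finset.mem_univ i)

variable [DecidableEq C]

lemma HPen_eq (H : StandardForm C Q) :
    H.HPen L = Matrix.diagonal fun x => (H.penCount x.1 : ℂ) := by
  classical
  ext x y
  by_cases h : x = y
  · subst h; simp [HPen, hPen, localTerm_diagonal, Matrix.sum_apply, penCount]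
  · simp [HPen, hPen, localTerm_diagonal, Matrix.sum_apply, h]

lemma HIn_eq (H : StandardForm C Q) :
    H.HIn L = Matrix.diagonal fun x => (H.inCount x.1 x.2 : ℂ) := by
  classical
  ext x y
  by_cases h : x = y
  · subst h; simp [HIn, hIn, localTerm_diagonal, Matrix.sum_apply, inCount]
  · simp [HIn, hIn, localTerm_diagonal, Matrix.sum_apply, h]

lemma HOut_eq (H : StandardForm C Q) :
    H.HOut L = Matrix.diagonal fun x => (H.outCount x.1 x.2 : ℂ) := by
  classical
  ext x y
  by_cases h : x = y
  · subst h
    simp only [HOut, hOut, localTerm_diagonal, Matrix.sum_apply, outCount,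
      Matrix.diagonal_apply_eq, Complex.ofReal_sum]
    exact Finset.sum_congr rfl fun i _ => by split_ifs <;> simp
  · simp [HOut, hOut, localTerm_diagonal, Matrix.sum_apply, h]

end Penalties

/-! ### Single transitions -/

section Steps

variable {L : ℕ} {C Q : Type*} [Fintype Q] [DecidableEq Q]

lemma stepVia_splice {H : StandardForm C Q} {i : Fin (L - 1)} {k : Fin L → C} {cd : C × C}
    {U : Matrix.unitaryGroup (Q × Q) ℂ} (h : H.trans (pairAt k i) cd = some U) :
    H.StepVia k (splice k i cd) (quantumTerm i (U : Matrix (Q × Q) (Q × Q) ℂ)) :=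
  ⟨i, U, by simpa using h, agreeOff_splice k i cd, rfl⟩

lemma splice_stepVia {H : StandardForm C Q} {i : Fin (L - 1)} {k : Fin L → C} {ab : C × C}
    {U : Matrix.unitaryGroup (Q × Q) ℂ} (h : H.trans ab (pairAt k i) = some U) :
    H.StepVia (splice k i ab) k (quantumTerm i (U : Matrix (Q × Q) (Q × Q) ℂ)) :=
  ⟨i, U, by simpa using h, (agreeOff_splice k i ab).symm, rfl⟩

end Steps

/-! ### Expectation values and the variational principle -/

section Energy

variable {L : ℕ} {C Q : Type*} [Fintype C] [Fintype Q] [DecidableEq Q]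

/-- The expectation value of `H_trans`, as a sum over all transitions `k → k'`. -/
noncomputable def transEnergy (H : StandardForm C Q) (v : (Fin L → C) × (Fin L → Q) → ℂ) : ℝ :=
  ∑ i, ∑ k, ∑ cd, (H.trans (pairAt k i) cd).elim 0 fun U => 1 / 2 * sqNorm
    (slice v (splice k i cd) - (quantumTerm i (U : Matrix (Q × Q) (Q × Q) ℂ)).mulVec (slice v k))

/-- The expectation value of `H_pen + H_in + H_out`. -/
noncomputable def penaltyEnergy (H : StandardForm C Q) (v : (Fin L → C) × (Fin L → Q) → ℂ) : ℝ :=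
  ∑ k, ∑ q, (H.penCount k + H.inCount k q + H.outCount k q) * ‖v (k, q)‖ ^ 2

lemma transEnergy_nonneg (H : StandardForm C Q) (v : (Fin L → C) × (Fin L → Q) → ℂ) :
    0 ≤ H.transEnergy v := by
  refine Finset.sum_nonneg fun i _ => Finset.sum_nonneg fun k _ => Finset.sum_nonneg fun cd _ => ?_
  cases H.trans (pairAt k i) cd with
  | none => exact le_rfl
  | some U => exact mul_nonneg (by norm_num) (sqNorm_nonneg _)

lemma penaltyEnergy_nonneg (H : StandardForm C Q) (v : (Fin L → C) × (Fin L → Q) → ℂ) :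
    0 ≤ H.penaltyEnergy v :=
  Finset.sum_nonneg fun k _ => Finset.sum_nonneg fun q _ => mul_nonneg
    (add_nonneg (add_nonneg (H.penCount_nonneg k) (H.inCount_nonneg k q)) (H.outCount_nonneg k q))
    (sq_nonneg _)

lemma sum_penCount_le_penaltyEnergy (H : StandardForm C Q)
    (v : (Fin L → C) × (Fin L → Q) → ℂ) :
    ∑ k, H.penCount k * sqNorm (slice v k) ≤ H.penaltyEnergy v := by
  refine Finset.sum_le_sum fun k _ => ?_
  rw [sqNorm, Finset.mul_sum]
  refine Finset.sum_le_sum fun q _ => mul_le_mul_of_nonneg_right ?_ (sq_nonneg _)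
  have := H.inCount_nonneg k q
  have := H.outCount_nonneg k q
  linarith

variable [DecidableEq C]

lemma hamiltonian_eq (H : StandardForm C Q) : H.hamiltonian L = H.HTrans L +
    Matrix.diagonal fun x => ((H.penCount x.1 + H.inCount x.1 x.2 + H.outCount x.1 x.2 : ℝ) : ℂ) := by
  rw [hamiltonian, HPen_eq, HIn_eq, HOut_eq, add_assoc, add_assoc, Matrix.diagonal_add,
    Matrix.diagonal_add]
  congr 2
  funext x
  push_cast
  ring

lemma dotProduct_hamiltonian_mulVec (H : StandardForm C Q)
    (v : (Fin L → C) × (Fin L → Q) → ℂ) :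
    star v ⬝ᵥ (H.hamiltonian L).mulVec v = ((H.transEnergy v + H.penaltyEnergy v : ℝ) : ℂ) := by
  rw [hamiltonian_eq, Matrix.add_mulVec, dotProduct_add, dotProduct_HTrans_mulVec,
    mulVec_diagonal_expectation, Complex.ofReal_add, transEnergy, penaltyEnergy,
    Fintype.sum_prod_type]

lemma hTrans_isHermitian (H : StandardForm C Q) : H.hTrans.IsHermitian := by
  rw [Matrix.IsHermitian, hTrans, Matrix.conjTranspose_sum]
  refine Finset.sum_congr rfl fun ab _ => ?_
  rw [Matrix.conjTranspose_sum]
  refine Finset.sum_congr rfl fun cd _ => ?_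
  cases H.trans ab cd with
  | none => simp
  | some U =>
    simp only [ruleTerm, Matrix.conjTranspose_smul, Matrix.conjTranspose_mul,
      Matrix.conjTranspose_conjTranspose]
    congr 1
    simp

lemma hamiltonian_isHermitian (H : StandardForm C Q) : (H.hamiltonian L).IsHermitian := by
  rw [hamiltonian_eq]
  refine Matrix.IsHermitian.add ?_ ?_
  · rw [Matrix.IsHermitian, HTrans, Matrix.conjTranspose_sum]
    exact Finset.sum_congr rfl fun i _ => by
      rw [localTerm_conjTranspose, H.hTrans_isHermitian.eq]
  · rw [Matrix.IsHermitian, Matrix.diagonal_conjTranspose]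
    congr 1
    funext x
    simp

/-- `K_S ⊗ H_Q` is invariant under the Hamiltonian if `S` is closed under the transition rules. -/
lemma hamiltonian_mulVec_eq_zero {H : StandardForm C Q} {S : Set (Fin L → C)}
    (hS : H.ClosedUnderRules S) {v : (Fin L → C) × (Fin L → Q) → ℂ}
    (hv : ∀ x, x.1 ∉ S → v x = 0) {x : (Fin L → C) × (Fin L → Q)} (hx : x.1 ∉ S) :
    (H.hamiltonian L).mulVec v x = 0 := by
  have hsl : ∀ k ∉ S, slice v k = 0 := fun k hk => slice_eq_zero hv hk
  rw [hamiltonian_eq, Matrix.add_mulVec, Pi.add_apply, Matrix.mulVec_diagonal, hv x hx, mul_zero,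
    add_zero, HTrans, Matrix.sum_mulVec, Finset.sum_apply]
  refine Finset.sum_eq_zero fun i _ => ?_
  obtain ⟨k, q⟩ := x
  change slice ((localTerm i H.hTrans).mulVec v) k q = 0
  rw [slice_localTerm_hTrans_mulVec, hsl k hx, Finset.sum_eq_zero, Finset.sum_eq_zero]
  · simp
  · intro ab _
    cases h : H.trans ab (pairAt k i) with
    | none => rfl
    | some U => simp [hsl _ fun h' => hx ((hS _ _ _ (splice_stepVia h)).1 h')]
  · intro cd _
    cases h : H.trans (pairAt k i) cd with
    | none => rfl
    | some U => simp [hsl _ fun h' => hx ((hS _ _ _ (stepVia_splice h)).2 h')]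

/-- A lower bound on expectation values bounds the least eigenvalue. -/
lemma le_of_mem_energies {H : StandardForm C Q} {S : Set (Fin L → C)} {c μ : ℝ}
    (h : ∀ v : (Fin L → C) × (Fin L → Q) → ℂ, (∀ x, x.1 ∉ S → v x = 0) →
      c * sqNorm v ≤ H.transEnergy v + H.penaltyEnergy v) (hμ : μ ∈ H.energies S) : c ≤ μ := by
  obtain ⟨v, hv0, hv, hμ⟩ := hμ
  have h1 := h v hv
  have h2 := H.dotProduct_hamiltonian_mulVec v
  rw [hμ, dotProduct_smul, ← ofReal_sqNorm, smul_eq_mul, ← Complex.ofReal_mul] at h2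
  rw [← Complex.ofReal_inj.1 h2] at h1
  exact le_of_mul_le_mul_right h1 (sqNorm_pos hv0)

/-- The variational principle on `K_S ⊗ H_Q`. -/
lemma exists_isLeast_energies [Nonempty (Fin L → Q)] {H : StandardForm C Q} {S : Set (Fin L → C)}
    (hS : H.ClosedUnderRules S) (hne : S.Nonempty) :
    ∃ lam : ℝ, IsLeast (H.energies S) lam ∧
      ∀ v : (Fin L → C) × (Fin L → Q) → ℂ, (∀ x, x.1 ∉ S → v x = 0) →
        lam * sqNorm v ≤ H.transEnergy v + H.penaltyEnergy v := by
  classical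
  let X := {x : (Fin L → C) × (Fin L → Q) // x.1 ∈ S}
  have : Nonempty X := ⟨⟨(hne.some, Classical.arbitrary _), hne.some_mem⟩⟩
  have hsum : ∀ f : (Fin L → C) × (Fin L → Q) → ℂ, (∀ x, x.1 ∉ S → f x = 0) →
      ∑ x : X, f x = ∑ x, f x := by
    intro f hf
    rw [← Finset.sum_filter_of_ne (p := fun x : (Fin L → C) × (Fin L → Q) => x.1 ∈ S)]
    · exact (Finset.sum_subtype _ (by simp) f).symm
    · intro x _ hx
      by_contra h
      exact hx (hf x h)
  obtain ⟨lam, ⟨w, hw0, hw⟩, hmin⟩ :=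
    ((H.hamiltonian_isHermitian (L := L)).submatrix (Subtype.val : X → _)).exists_least_eigenvalue
  have hres : ∀ v : (Fin L → C) × (Fin L → Q) → ℂ, (∀ x, x.1 ∉ S → v x = 0) → ∀ x : X,
      ((H.hamiltonian L).submatrix Subtype.val Subtype.val).mulVec (fun y : X => v y) x =
        (H.hamiltonian L).mulVec v x := by
    intro v hv x
    simp only [Matrix.mulVec, dotProduct, Matrix.submatrix_apply]
    exact hsum (fun y => H.hamiltonian L x y * v y) fun y hy => by rw [hv y hy, mul_zero]
  have hray : ∀ v : (Fin L → C) × (Fin L → Q) → ℂ, (∀ x, x.1 ∉ S → v x = 0) →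
      lam * sqNorm v ≤ H.transEnergy v + H.penaltyEnergy v := by
    intro v hv
    have h1 : sqNorm (fun y : X => v y) = sqNorm v := by
      have : (sqNorm (fun y : X => v y) : ℂ) = sqNorm v := by
        rw [ofReal_sqNorm, ofReal_sqNorm]
        exact hsum (fun y => star (v y) * v y) fun y hy => by rw [hv y hy, mul_zero]
      exact_mod_cast this
    have h2 := hmin fun y : X => v y
    rw [h1] at h2
    refine h2.trans_eq ?_
    have h3 : star (fun y : X => v y) ⬝ᵥ
        ((H.hamiltonian L).submatrix Subtype.val Subtype.val).mulVec (fun y : X => v y) =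
        star v ⬝ᵥ (H.hamiltonian L).mulVec v := by
      simp only [dotProduct, hres v hv]
      exact hsum (fun y => star (v y) * (H.hamiltonian L).mulVec v y) fun y hy => by
        rw [hv y hy, star_zero, zero_mul]
    rw [h3, dotProduct_hamiltonian_mulVec, Complex.ofReal_re]
  refine ⟨lam, ⟨⟨fun x => if h : x.1 ∈ S then w ⟨x, h⟩ else 0, ?_, ?_, ?_⟩, ?_⟩, hray⟩
  · intro h
    refine hw0 (funext fun x => ?_)
    simpa [x.2] using congrFun h x
  · intro x hx
    simp [hx]
  · have hv : ∀ x : (Fin L → C) × (Fin L → Q), x.1 ∉ S →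
        (if h : x.1 ∈ S then w ⟨x, h⟩ else 0) = 0 := fun x hx => dif_neg hx
    funext x
    by_cases hx : x.1 ∈ S
    · rw [← hres _ hv ⟨x, hx⟩]
      have : (fun y : X => if h : (y : (Fin L → C) × (Fin L → Q)).1 ∈ S then w ⟨y, h⟩ else 0) = w :=
        funext fun y => dif_pos y.2
      rw [this, hw]
      simp [hx]
    · rw [hamiltonian_mulVec_eq_zero hS hv hx]
      simp [hx]
  · exact fun μ hμ => le_of_mem_energies hray hμ

end Energy

end StandardForm

/-! ### The energy of a single transition -/

section EdgeInequality

/-- A weighted inequality of arithmetic and geometric means. With `r = w b / w a` for a positive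
weight `w` it bounds the Laplacian of a graph from below by a diagonal term, which on a positive
eigenvector `w` gives the eigenvalue. -/
lemma le_norm_sub_sq (a b : ℂ) {r : ℝ} (hr : 0 < r) :
    (1 - r) * ‖a‖ ^ 2 + (1 - r⁻¹) * ‖b‖ ^ 2 ≤ ‖b - a‖ ^ 2 := by
  have h1 : (‖b‖ - ‖a‖) ^ 2 ≤ ‖b - a‖ ^ 2 := by
    rw [← sq_abs (‖b‖ - ‖a‖)]
    exact pow_le_pow_left₀ (abs_nonneg _) (abs_norm_sub_norm_le b a) 2
  have h2 : 0 ≤ r * (‖a‖ - r⁻¹ * ‖b‖) ^ 2 := mul_nonneg hr.le (sq_nonneg _)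
  have h3 : r * (‖a‖ - r⁻¹ * ‖b‖) ^ 2 = r * ‖a‖ ^ 2 - 2 * ‖a‖ * ‖b‖ + r⁻¹ * ‖b‖ ^ 2 := by
    field_simp
    ring
  nlinarith

lemma le_sqNorm_sub_mulVec {n : Type*} [Fintype n] [DecidableEq n] {G : Matrix n n ℂ}
    (hG : G ∈ Matrix.unitaryGroup n ℂ) (a b : n → ℂ) {r : ℝ} (hr : 0 < r) :
    (1 - r) * sqNorm a + (1 - r⁻¹) * sqNorm b ≤ sqNorm (b - G.mulVec a) := by
  rw [← sqNorm_mulVec hG a]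
  simp only [sqNorm, Finset.mul_sum, ← Finset.sum_add_distrib]
  exact Finset.sum_le_sum fun q _ => le_norm_sub_sq _ _ hr

end EdgeInequality

/-! ### Sums with at most one term -/

section OptionSums

variable {α β : Type*} [Fintype α] {o : α → Option β}

lemma sum_elim_eq_of_subsingleton {M : Type*} [AddCommMonoid M] (h : {p | o p ≠ none}.Subsingleton)
    (φ : α → β → M) {p : α} {b : β} (hp : o p = some b) :
    ∑ p, (o p).elim 0 (φ p) = φ p b := by
  rw [Finset.sum_eq_single p, hp, Option.elim_some]
  · intro p' _ hne
    cases h' : o p' with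
    | none => rfl
    | some b' => exact absurd (h (by simp [h'] : o p' ≠ none) (by simp [hp] : o p ≠ none)) hne
  · simp

lemma le_sum_elim_of_subsingleton (h : {p | o p ≠ none}.Subsingleton) (φ : α → β → ℝ) {B : ℝ}
    (hB : B ≤ 0) (hφ : ∀ p b, o p = some b → B ≤ φ p b) : B ≤ ∑ p, (o p).elim 0 (φ p) := by
  by_cases hp : ∃ p, o p ≠ none
  · obtain ⟨p, hp⟩ := hp
    obtain ⟨b, hb⟩ := Option.ne_none_iff_exists'.1 hp
    rw [sum_elim_eq_of_subsingleton h φ hb]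
    exact hφ p b hb
  · push Not at hp
    simp [hp, hB]

end OptionSums

namespace StandardForm

/-! ### Cells of clock states -/

section Cells

variable {L : ℕ} {C Q : Type*} [Fintype Q] [DecidableEq Q] {H : StandardForm C Q}
  {S : Set (Fin L → C)}

lemma StepVia.exists_eq_splice {k k' : Fin L → C} {G : Matrix (Fin L → Q) (Fin L → Q) ℂ}
    (h : H.StepVia k k' G) : ∃ i cd U, H.trans (pairAt k i) cd = some U ∧ k' = splice k i cd ∧
      G = quantumTerm i (U : Matrix (Q × Q) (Q × Q) ℂ) := by
  obtain ⟨i, U, hU, hk, rfl⟩ := h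
  exact ⟨i, pairAt k' i, U, hU, hk.eq_splice.symm, rfl⟩

lemma StepVia.exists_splice_eq {k k' : Fin L → C} {G : Matrix (Fin L → Q) (Fin L → Q) ℂ}
    (h : H.StepVia k k' G) : ∃ i ab U, H.trans ab (pairAt k' i) = some U ∧ k = splice k' i ab ∧
      G = quantumTerm i (U : Matrix (Q × Q) (Q × Q) ℂ) := by
  obtain ⟨i, U, hU, hk, rfl⟩ := h
  exact ⟨i, pairAt k i, U, hU, hk.symm.eq_splice.symm, rfl⟩

lemma StepVia.mem_unitaryGroup {k k' : Fin L → C} {G : Matrix (Fin L → Q) (Fin L → Q) ℂ}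
    (h : H.StepVia k k' G) : G ∈ Matrix.unitaryGroup (Fin L → Q) ℂ := by
  obtain ⟨i, U, -, -, rfl⟩ := h
  exact quantumTerm_mem_unitaryGroup i U

lemma IsCell.subset_of_mem (hS : H.IsCell S) {W : Set (Fin L → C)} (hW : H.ClosedUnderRules W)
    {k : Fin L → C} (hk : k ∈ S) (hkW : k ∈ W) : S ⊆ W := by
  have h : S ⊆ S ∩ W := hS.2 ⟨⟨k, hk, hkW⟩, fun k k' G h =>
    and_congr (hS.1.2 k k' G h) (hW k k' G h)⟩ Set.inter_subset_left
  exact fun k hk => (h hk).2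

end Cells

/-! ### Lower bounds from positive weights -/

section Weights

variable {L : ℕ} {C Q : Type*} [Fintype C] [Fintype Q] [DecidableEq Q] {H : StandardForm C Q}
  {S : Set (Fin L → C)}

/-- A positive weight `w` that satisfies `(½ Δ + penalty) w ≥ c w` on `S`, where `Δ` is the
Laplacian of the graph of transitions, certifies the lower bound `c` on the energy. -/
lemma le_energy_of_weight (hS : H.ClosedUnderRules S) {w : (Fin L → C) → ℝ}
    (hw : ∀ k ∈ S, 0 < w k) {c : ℝ}
    (hc : ∀ k ∈ S, c ≤
      ∑ i, ∑ cd, (H.trans (pairAt k i) cd).elim 0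
        (fun _ => 1 / 2 * (1 - w (splice k i cd) / w k)) +
      ∑ i, ∑ ab, (H.trans ab (pairAt k i)).elim 0
        (fun _ => 1 / 2 * (1 - w (splice k i ab) / w k)) + H.penCount k)
    {v : (Fin L → C) × (Fin L → Q) → ℂ} (hv : ∀ x, x.1 ∉ S → v x = 0) :
    c * sqNorm v ≤ H.transEnergy v + H.penaltyEnergy v := by
  have hsl : ∀ k ∉ S, sqNorm (slice v k) = 0 := fun k hk =>
    sqNorm_slice_eq_zero hv hk
  have h1 : ∑ i, ∑ k, ∑ cd, ((H.trans (pairAt k i) cd).elim 0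
        (fun _ => 1 / 2 * (1 - w (splice k i cd) / w k) * sqNorm (slice v k)) +
      (H.trans (pairAt k i) cd).elim 0 (fun _ => 1 / 2 * (1 - w k / w (splice k i cd)) *
        sqNorm (slice v (splice k i cd)))) ≤ H.transEnergy v := by
    refine Finset.sum_le_sum fun i _ => Finset.sum_le_sum fun k _ => Finset.sum_le_sum fun cd _ => ?_
    cases h : H.trans (pairAt k i) cd with
    | none => simp
    | some U =>
      simp only [Option.elim_some]
      have hiff := hS _ _ _ (stepVia_splice h)
      by_cases hk : k ∈ S
      · have hk' := hiff.1 hk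
        have := le_sqNorm_sub_mulVec (quantumTerm_mem_unitaryGroup i U) (slice v k)
          (slice v (splice k i cd)) (div_pos (hw _ hk') (hw _ hk))
        rw [inv_div] at this
        linarith
      · rw [hsl k hk, hsl _ fun h' => hk (hiff.2 h'), mul_zero, mul_zero, add_zero]
        exact mul_nonneg (by norm_num) (sqNorm_nonneg _)
  have h2 : ∀ i, ∑ k, ∑ cd, (H.trans (pairAt k i) cd).elim 0
      (fun _ => 1 / 2 * (1 - w k / w (splice k i cd)) * sqNorm (slice v (splice k i cd))) =
      ∑ k, ∑ ab, (H.trans ab (pairAt k i)).elim 0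
        (fun _ => 1 / 2 * (1 - w (splice k i ab) / w k) * sqNorm (slice v k)) := by
    intro i
    rw [← sum_splice_comm i]
    simp
  simp only [Finset.sum_add_distrib, h2] at h1
  rw [Finset.sum_comm, Finset.sum_comm (s := (Finset.univ : Finset (Fin (L - 1))))] at h1
  have h3 := H.sum_penCount_le_penaltyEnergy v
  have hel : ∀ (o : Option (Matrix.unitaryGroup (Q × Q) ℂ)) (x y : ℝ),
      o.elim 0 (fun _ => 1 / 2 * x * y) = o.elim 0 (fun _ => 1 / 2 * x) * y := by
    intro o x y
    cases o <;> simp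
  have h4 : c * sqNorm v ≤ ∑ k, (∑ i, ∑ cd, (H.trans (pairAt k i) cd).elim 0
        (fun _ => 1 / 2 * (1 - w (splice k i cd) / w k)) +
      ∑ i, ∑ ab, (H.trans ab (pairAt k i)).elim 0
        (fun _ => 1 / 2 * (1 - w (splice k i ab) / w k)) + H.penCount k) *
          sqNorm (slice v k) := by
    rw [sqNorm_eq_sum_slice, Finset.mul_sum]
    refine Finset.sum_le_sum fun k _ => ?_
    by_cases hk : k ∈ S
    · exact mul_le_mul_of_nonneg_right (hc k hk) (sqNorm_nonneg _)
    · rw [hsl k hk, mul_zero, mul_zero]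
  simp only [add_mul, Finset.sum_add_distrib] at h4
  simp only [hel, ← Finset.sum_mul] at h1
  linarith

lemma one_mul_sqNorm_le_energy (hS : ∀ k ∈ S, ¬ H.Legal k)
    {v : (Fin L → C) × (Fin L → Q) → ℂ} (hv : ∀ x, x.1 ∉ S → v x = 0) :
    1 * sqNorm v ≤ H.transEnergy v + H.penaltyEnergy v := by
  have h1 : 1 * sqNorm v ≤ ∑ k, H.penCount k * sqNorm (slice v k) := by
    rw [sqNorm_eq_sum_slice, Finset.mul_sum]
    refine Finset.sum_le_sum fun k _ => ?_
    by_cases hk : k ∈ S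
    · exact mul_le_mul_of_nonneg_right (one_le_penCount (hS k hk)) (sqNorm_nonneg _)
    · rw [sqNorm_slice_eq_zero hv hk, mul_zero, mul_zero]
  linarith [H.sum_penCount_le_penaltyEnergy v, H.transEnergy_nonneg v]

end Weights

/-! ### The distance to an illegal state -/

section RapidIllegal

variable {L : ℕ} {C Q : Type*} [Fintype Q] [DecidableEq Q] {H : StandardForm C Q}

/-- `k` can be joined to an illegal state by `n` transitions, forwards or backwards. -/
def NearIllegal (H : StandardForm C Q) : ℕ → (Fin L → C) → Prop
  | 0, k => ¬ H.Legal k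
  | n + 1, k => ∃ k' G, (H.StepVia k k' G ∨ H.StepVia k' k G) ∧ H.NearIllegal n k'

/-- The least number of transitions, forwards or backwards, from `k` to an illegal state
(and `0` if there is no illegal state to be reached). -/
noncomputable def distIllegal (H : StandardForm C Q) (k : Fin L → C) : ℕ :=
  sInf {n | H.NearIllegal n k}

lemma Evolves.nearIllegal_left {k k' : Fin L → C} {n m : ℕ}
    {F : Matrix (Fin L → Q) (Fin L → Q) ℂ} (h : H.Evolves k n F k') (h' : H.NearIllegal m k') :
    H.NearIllegal (n + m) k := by
  induction h generalizing m with
  | refl => simpa using h'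
  | step _ hs ih =>
    have := ih (m := m + 1) ⟨_, _, Or.inl hs, h'⟩
    rwa [← add_assoc, add_right_comm] at this

lemma Evolves.nearIllegal_right {k k' : Fin L → C} {n m : ℕ}
    {F : Matrix (Fin L → Q) (Fin L → Q) ℂ} (h : H.Evolves k n F k') (h' : H.NearIllegal m k) :
    H.NearIllegal (n + m) k' := by
  induction h with
  | refl => simpa using h'
  | step _ hs ih =>
    rw [add_right_comm]
    exact (⟨_, _, Or.inr hs, ih⟩ : H.NearIllegal (_ + 1) _)

lemma distIllegal_le {k : Fin L → C} {n : ℕ} (h : H.NearIllegal n k) : H.distIllegal k ≤ n :=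
  Nat.sInf_le h

lemma nearIllegal_distIllegal {k : Fin L → C} {n : ℕ} (h : H.NearIllegal n k) :
    H.NearIllegal (H.distIllegal k) k :=
  Nat.sInf_mem (s := {n | H.NearIllegal n k}) ⟨n, h⟩

variable {Tinit : ℕ} {S : Set (Fin L → C)}

lemma IsStandardFormClock.exists_nearIllegal (hclock : H.IsStandardFormClock L Tinit)
    (hS : H.IsCell S) (hill : ∃ k ∈ S, ¬ H.Legal k) {k : Fin L → C} (hk : k ∈ S) :
    ∃ n ≤ 2 * L, H.NearIllegal n k := by
  by_cases hleg : H.Legal k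
  · obtain ⟨k', hk', n, hn, F, h | h⟩ := hclock.rapid_illegal S hS hill k hk hleg
    · exact ⟨n, hn, h.nearIllegal_left (m := 0) hk'⟩
    · exact ⟨n, hn, h.nearIllegal_right (m := 0) hk'⟩
  · exact ⟨0, Nat.zero_le _, hleg⟩

end RapidIllegal

end StandardForm

/-! ### The weight for cells with illegal states -/

section RapidWeight

/-- The amplitude, at distance `d` from an illegal state, of the lowest mode of a path of legal
states that is free at its far end at distance `2 L`. -/
noncomputable def rapidWeight (L d : ℕ) : ℝ :=
  Real.cos (Real.pi / (8 * L) * (2 * L - d + 1 / 2))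

variable {L : ℕ}

lemma rapidWeight_angle (hL : 1 ≤ L) :
    0 < Real.pi / (8 * L) ∧ Real.pi / (8 * L) ≤ Real.pi / 8 ∧
      Real.pi / (8 * L) * (2 * L) = Real.pi / 4 := by
  have hL' : (1 : ℝ) ≤ L := by exact_mod_cast hL
  have hL0 : (0 : ℝ) < L := by linarith
  refine ⟨by positivity, ?_, by field_simp; norm_num⟩
  exact div_le_div_of_nonneg_left Real.pi_pos.le (by norm_num) (by linarith)

lemma rapidWeight_pos (hL : 1 ≤ L) {d : ℕ} (hd : d ≤ 2 * L) : 0 < rapidWeight L d := by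
  obtain ⟨h0, h1, h2⟩ := rapidWeight_angle hL
  have hd' : (d : ℝ) ≤ 2 * L := by exact_mod_cast hd
  have hd0 : (0 : ℝ) ≤ d := Nat.cast_nonneg d
  refine Real.cos_pos_of_mem_Ioo ⟨?_, ?_⟩
  · have : 0 ≤ Real.pi / (8 * L) * (2 * L - d + 1 / 2) :=
      mul_nonneg h0.le (by linarith)
    linarith [Real.pi_pos]
  · have : Real.pi / (8 * L) * (2 * L - d + 1 / 2) ≤
        Real.pi / (8 * L) * (2 * L) + Real.pi / (8 * L) * (1 / 2) := by
      rw [← mul_add]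
      exact mul_le_mul_of_nonneg_left (by linarith) h0.le
    linarith [Real.pi_pos]

lemma rapidWeight_mono (hL : 1 ≤ L) {d d' : ℕ} (hdd' : d ≤ d') (hd' : d' ≤ 2 * L) :
    rapidWeight L d ≤ rapidWeight L d' := by
  obtain ⟨h0, h1, h2⟩ := rapidWeight_angle hL
  have hd2 : (d' : ℝ) ≤ 2 * L := by exact_mod_cast hd'
  have hd1 : (d : ℝ) ≤ d' := by exact_mod_cast hdd'
  have hd0 : (0 : ℝ) ≤ d := Nat.cast_nonneg d
  refine Real.cos_le_cos_of_nonneg_of_le_pi (mul_nonneg h0.le (by linarith)) ?_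
    (mul_le_mul_of_nonneg_left (by linarith) h0.le)
  have : Real.pi / (8 * L) * (2 * L - d + 1 / 2) ≤
      Real.pi / (8 * L) * (2 * L) + Real.pi / (8 * L) * (1 / 2) := by
    rw [← mul_add]
    exact mul_le_mul_of_nonneg_left (by linarith) h0.le
  linarith [Real.pi_pos]

lemma rapidWeight_le_succ (hL : 1 ≤ L) {d d' : ℕ} (hdd' : d' ≤ d + 1) (hd' : d' ≤ 2 * L)
    (hd : d ≤ 2 * L) : rapidWeight L d' ≤ rapidWeight L (d + 1) := by
  rcases hd.eq_or_lt with rfl | hd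
  · -- the mode is reflected at the far end, so that the value one step beyond it is the same
    have : rapidWeight L (2 * L + 1) = rapidWeight L (2 * L) := by
      rw [rapidWeight, rapidWeight, ← Real.cos_neg]
      congr 1
      push_cast
      ring
    rw [this]
    exact rapidWeight_mono hL hd' le_rfl
  · exact rapidWeight_mono hL hdd' hd

lemma rapidWeight_add (d : ℕ) :
    rapidWeight L d + rapidWeight L (d + 2) =
      2 * Real.cos (Real.pi / (8 * L)) * rapidWeight L (d + 1) := by
  have h1 : rapidWeight L d = Real.cos (Real.pi / (8 * L) * (2 * L - (d + 1 : ℕ) + 1 / 2) +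
      Real.pi / (8 * L)) := by
    rw [rapidWeight]; congr 1; push_cast; ring
  have h2 : rapidWeight L (d + 2) = Real.cos (Real.pi / (8 * L) * (2 * L - (d + 1 : ℕ) + 1 / 2) -
      Real.pi / (8 * L)) := by
    rw [rapidWeight]; congr 1; push_cast; ring
  rw [h1, h2, Real.cos_add, Real.cos_sub, rapidWeight]
  ring

lemma rapidWeight_one_le (hL : 1 ≤ L) :
    rapidWeight L 1 ≤ (1 + Real.cos (Real.pi / (8 * L))) * rapidWeight L 0 := by
  obtain ⟨h0, h1, h2⟩ := rapidWeight_angle hL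
  set θ := Real.pi / (8 * L) with hθ
  have hpi := Real.pi_pos
  have e0 : rapidWeight L 0 = Real.cos (Real.pi / 4 + θ / 2) := by
    rw [rapidWeight, ← h2, ← hθ]; congr 1; push_cast; ring
  have e1 : rapidWeight L 1 = Real.cos (Real.pi / 4 + θ / 2 - θ) := by
    rw [rapidWeight, ← h2, ← hθ]; congr 1; push_cast; ring
  -- it remains to see that `sin β * sin θ ≤ cos β` for `β = π / 4 + θ / 2 ≤ π / 3`, `θ ≤ π / 6`
  have hcos : 1 / 2 ≤ Real.cos (Real.pi / 4 + θ / 2) := by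
    rw [← Real.cos_pi_div_three]
    exact Real.cos_le_cos_of_nonneg_of_le_pi (by linarith) (by linarith) (by linarith)
  have hsin : Real.sin θ ≤ 1 / 2 := by
    rw [← Real.sin_pi_div_six]
    exact Real.sin_le_sin_of_le_of_le_pi_div_two (by linarith) (by linarith) (by linarith)
  have hsin0 : 0 ≤ Real.sin θ := Real.sin_nonneg_of_nonneg_of_le_pi h0.le (by linarith)
  have := mul_le_of_le_one_left hsin0 (Real.sin_le_one (Real.pi / 4 + θ / 2))
  rw [e0, e1, Real.cos_sub]
  linarith

end RapidWeight

namespace StandardForm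

/-! ### Cells with legal and illegal states -/

section MixedCells

variable {L : ℕ} {C Q : Type*} [Fintype C] [Fintype Q] [DecidableEq Q] {H : StandardForm C Q}
  {Tinit : ℕ} {S : Set (Fin L → C)}

/-- A cell with legal and illegal states is a path or a cycle on which every state is at distance at
most `2 L` from an illegal one. -/
lemma IsStandardFormClock.le_energy_of_mixed (hclock : H.IsStandardFormClock L Tinit)
    (hS : H.IsCell S) (hleg : ∃ k ∈ S, H.Legal k) (hill : ∃ k ∈ S, ¬ H.Legal k)
    {v : (Fin L → C) × (Fin L → Q) → ℂ} (hv : ∀ x, x.1 ∉ S → v x = 0) :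
    (1 - Real.cos (Real.pi / (8 * (L : ℝ)))) * sqNorm v ≤ H.transEnergy v + H.penaltyEnergy v := by
  obtain ⟨W, hlegW, hW, hsub⟩ := hclock.exists_wellFormed
  obtain ⟨k₀, hk₀, hk₀leg⟩ := hleg
  have hSW := hS.subset_of_mem hW hk₀ (hlegW k₀ hk₀leg)
  have hL : 1 ≤ L := by
    obtain ⟨k, -, hk⟩ := hill
    by_contra! h
    obtain rfl : L = 0 := by omega
    exact hk fun i => i.elim0
  set c := Real.cos (Real.pi / (8 * (L : ℝ))) with hc
  have hnear := fun k hk => hclock.exists_nearIllegal hS hill (k := k) hk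
  have hd : ∀ k ∈ S, H.distIllegal k ≤ 2 * L := by
    intro k hk
    obtain ⟨n, hn, h⟩ := hnear k hk
    exact (distIllegal_le h).trans hn
  have hpos : ∀ k ∈ S, 0 < rapidWeight L (H.distIllegal k) :=
    fun k hk => rapidWeight_pos hL (hd k hk)
  refine le_energy_of_weight hS.1.2 (w := fun k => rapidWeight L (H.distIllegal k)) hpos ?_ hv
  intro k hk
  rw [← Fintype.sum_prod_type', ← Fintype.sum_prod_type']
  obtain ⟨hfwd, hbwd⟩ := hsub k (hSW hk)
  obtain ⟨n, -, hn⟩ := hnear k hk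
  have hkpos := hpos k hk
  set d := H.distIllegal k with hdk
  have hdist := nearIllegal_distIllegal hn
  rw [← hdk] at hdist
  have hstep : ∀ k' G, H.StepVia k k' G ∨ H.StepVia k' k G → k' ∈ S ∧ H.distIllegal k' ≤ d + 1 := by
    intro k' G h
    refine ⟨?_, distIllegal_le ⟨k, G, h.symm, hdist⟩⟩
    rcases h with h | h
    · exact (hS.1.2 _ _ _ h).1 hk
    · exact (hS.1.2 _ _ _ h).2 hk
  have hle : ∀ k' G, H.StepVia k k' G ∨ H.StepVia k' k G →
      1 / 2 * (1 - rapidWeight L (d + 1) / rapidWeight L d) ≤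
        1 / 2 * (1 - rapidWeight L (H.distIllegal k') / rapidWeight L d) := by
    intro k' G h
    obtain ⟨hk', hk'd⟩ := hstep k' G h
    have := div_le_div_of_nonneg_right (rapidWeight_le_succ hL hk'd (hd k' hk') (hd k hk)) hkpos.le
    linarith
  have hneg : 1 / 2 * (1 - rapidWeight L (d + 1) / rapidWeight L d) ≤ 0 := by
    have := (one_le_div hkpos).2 (rapidWeight_le_succ hL d.le_succ (hd k hk) (hd k hk))
    linarith
  have hF := le_sum_elim_of_subsingleton hfwd
    (fun p _ => 1 / 2 * (1 - rapidWeight L (H.distIllegal (splice k p.1 p.2)) / rapidWeight L d))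
    hneg fun p U h => hle _ _ (Or.inl (stepVia_splice h))
  have hB := le_sum_elim_of_subsingleton hbwd
    (fun p _ => 1 / 2 * (1 - rapidWeight L (H.distIllegal (splice k p.1 p.2)) / rapidWeight L d))
    hneg fun p U h => hle _ _ (Or.inr (splice_stepVia h))
  rcases hd0 : d with _ | m
  · -- at an illegal state the penalty pays for the two neighbours
    rw [hd0] at hdist hF hB hkpos
    have h1 := one_le_penCount (H := H) hdist
    have h2 := (div_le_iff₀ hkpos).2 (rapidWeight_one_le hL)
    simp only [zero_add] at hF hB
    linarith
  · -- at a legal state one of the neighbours is closer to an illegal state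
    rw [hd0] at hdist hF hB hkpos
    have h0 := H.penCount_nonneg k
    have hadd : rapidWeight L m / rapidWeight L (m + 1) +
        rapidWeight L (m + 1 + 1) / rapidWeight L (m + 1) = 2 * c := by
      rw [← add_div, rapidWeight_add, mul_div_assoc, div_self hkpos.ne', mul_one]
    have hcloser : ∀ k' : Fin L → C, H.NearIllegal m k' →
        1 / 2 * (1 - rapidWeight L m / rapidWeight L (m + 1)) ≤
          1 / 2 * (1 - rapidWeight L (H.distIllegal k') / rapidWeight L (m + 1)) := by
      intro k' h
      have hm : m ≤ 2 * L := by have := hd k hk; omega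
      have := div_le_div_of_nonneg_right (rapidWeight_mono hL (distIllegal_le h) hm) hkpos.le
      linarith
    obtain ⟨k', G, h | h, hk'⟩ := hdist
    · obtain ⟨i, cd, U, hU, rfl, -⟩ := h.exists_eq_splice
      have := hcloser _ hk'
      rw [sum_elim_eq_of_subsingleton hfwd (p := (i, cd)) _ hU] at hF ⊢
      linarith
    · obtain ⟨i, ab, U, hU, rfl, -⟩ := h.exists_splice_eq
      have := hcloser _ hk'
      rw [sum_elim_eq_of_subsingleton hbwd (p := (i, ab)) _ hU] at hB ⊢
      linarith

end MixedCells

end StandardForm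

/-! ### The path with a penalty at one vertex -/

section Chain

/-- The amplitude at time `t` of the lowest mode of a path with the `N + 1` vertices `0, …, N` that
is free at `0` and has a unit penalty at `N`. -/
noncomputable def chainMode (N t : ℕ) : ℝ :=
  Real.cos (Real.pi / (2 * (N + 1)) * (t + 1 / 2))

lemma chainMode_angle (N : ℕ) :
    0 < Real.pi / (2 * ((N : ℝ) + 1)) ∧ Real.pi / (2 * ((N : ℝ) + 1)) * (N + 1) = Real.pi / 2 := by
  refine ⟨by positivity, by field_simp⟩

lemma chainMode_pos {N t : ℕ} (ht : t ≤ N) : 0 < chainMode N t := by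
  obtain ⟨h0, h1⟩ := chainMode_angle N
  have ht' : (t : ℝ) ≤ N := by exact_mod_cast ht
  have ht0 : (0 : ℝ) ≤ t := Nat.cast_nonneg t
  refine Real.cos_pos_of_mem_Ioo ⟨?_, ?_⟩
  · have : 0 ≤ Real.pi / (2 * ((N : ℝ) + 1)) * (t + 1 / 2) := mul_nonneg h0.le (by linarith)
    linarith [Real.pi_pos]
  · rw [← h1]
    exact mul_lt_mul_of_pos_left (by linarith) h0

lemma chainMode_add (N t : ℕ) : chainMode N t + chainMode N (t + 2) =
    2 * Real.cos (Real.pi / (2 * (N + 1))) * chainMode N (t + 1) := by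
  have h1 : chainMode N t = Real.cos (Real.pi / (2 * (N + 1)) * ((t + 1 : ℕ) + 1 / 2) -
      Real.pi / (2 * (N + 1))) := by
    rw [chainMode]; congr 1; push_cast; ring
  have h2 : chainMode N (t + 2) = Real.cos (Real.pi / (2 * (N + 1)) * ((t + 1 : ℕ) + 1 / 2) +
      Real.pi / (2 * (N + 1))) := by
    rw [chainMode]; congr 1; push_cast; ring
  rw [h1, h2, Real.cos_sub, Real.cos_add, chainMode]
  ring

lemma chainMode_one (N : ℕ) : chainMode N 1 =
    (2 * Real.cos (Real.pi / (2 * (N + 1))) - 1) * chainMode N 0 := by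
  have h1 : chainMode N 1 = Real.cos (Real.pi / (2 * (N + 1)) * ((0 : ℕ) + 1 / 2) +
      Real.pi / (2 * (N + 1))) := by
    rw [chainMode]; congr 1; push_cast; ring
  -- the mode is reflected at the free end
  have h2 : chainMode N 0 = Real.cos (Real.pi / (2 * (N + 1)) * ((0 : ℕ) + 1 / 2) -
      Real.pi / (2 * (N + 1))) := by
    rw [chainMode, ← Real.cos_neg]; congr 1; push_cast; ring
  have h3 : chainMode N 1 + chainMode N 0 =
      2 * Real.cos (Real.pi / (2 * (N + 1))) * chainMode N 0 := by
    conv_lhs => rw [h1, h2]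
    rw [Real.cos_sub, Real.cos_add, chainMode]
    ring
  linarith

lemma chainMode_last (N : ℕ) : chainMode N (N + 1) = - chainMode N N := by
  obtain ⟨-, h1⟩ := chainMode_angle N
  rw [chainMode, chainMode, ← Real.cos_pi_sub]
  congr 1
  push_cast
  linarith

/-- Summation by parts for the energy of `chainMode N` on the path `0, …, n`. -/
lemma sum_chainMode (N n : ℕ) :
    ∑ t ∈ Finset.range n, 1 / 2 * (chainMode N (t + 1) - chainMode N t) ^ 2 =
      (1 - Real.cos (Real.pi / (2 * (N + 1)))) * ∑ t ∈ Finset.range (n + 1), chainMode N t ^ 2 +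
        1 / 2 * chainMode N n * (chainMode N (n + 1) - chainMode N n) := by
  induction n with
  | zero =>
    simp only [Finset.range_zero, Finset.sum_empty, zero_add, Finset.sum_range_one, chainMode_one]
    ring
  | succ n ih =>
    rw [Finset.sum_range_succ, ih, Finset.sum_range_succ _ (n + 1)]
    have := chainMode_add N n
    have h : chainMode N (n + 1 + 1) = 2 * Real.cos (Real.pi / (2 * (N + 1))) *
        chainMode N (n + 1) - chainMode N n := by linarith
    rw [h]
    ring

/-- The energy of `chainMode N` on the path `0, …, N` with a unit penalty at `N`. -/
lemma sum_chainMode_add_sq (N : ℕ) :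
    ∑ t ∈ Finset.range N, 1 / 2 * (chainMode N (t + 1) - chainMode N t) ^ 2 + chainMode N N ^ 2 =
      (1 - Real.cos (Real.pi / (2 * (N + 1)))) * ∑ t ∈ Finset.range (N + 1), chainMode N t ^ 2 := by
  rw [sum_chainMode, chainMode_last]
  ring

/-- The lower bound on the energy of a path that is free at `0`, as seen from its other end `n`. -/
lemma le_sum_norm_sub_sq {N n : ℕ} (hn : n ≤ N) (u : ℕ → ℂ) :
    (1 - Real.cos (Real.pi / (2 * (N + 1)))) * ∑ t ∈ Finset.range (n + 1), ‖u t‖ ^ 2 +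
        1 / 2 * (chainMode N (n + 1) / chainMode N n - 1) * ‖u n‖ ^ 2 ≤
      ∑ t ∈ Finset.range n, 1 / 2 * ‖u (t + 1) - u t‖ ^ 2 := by
  induction n with
  | zero =>
    have h0 := chainMode_pos (Nat.zero_le N)
    simp only [zero_add, chainMode_one, mul_div_assoc, div_self h0.ne', Finset.range_zero,
      Finset.sum_empty, Finset.sum_range_one]
    linarith
  | succ n ih =>
    have h0 := chainMode_pos (show n ≤ N by omega)
    have h1 := chainMode_pos hn
    have h2 := ih (by omega)
    rw [Finset.sum_range_succ, Finset.sum_range_succ (fun t => 1 / 2 * ‖u (t + 1) - u t‖ ^ 2)]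
    have h3 := le_norm_sub_sq (u n) (u (n + 1)) (div_pos h1 h0)
    rw [inv_div] at h3
    have h4 : chainMode N (n + 1 + 1) / chainMode N (n + 1) =
        2 * Real.cos (Real.pi / (2 * (N + 1))) - chainMode N n / chainMode N (n + 1) := by
      have := chainMode_add N n
      rw [eq_sub_iff_add_eq, ← add_div, add_comm, this, mul_div_assoc, div_self h1.ne', mul_one]
    rw [h4]
    linarith

/-- Wherever on the path the two parts of it meet, a unit penalty there makes up for the
mismatch of the slopes of their lowest modes. -/
lemma chainMode_slopes (τ m : ℕ) :
    0 ≤ (1 - Real.cos (Real.pi / (2 * ((τ + m : ℕ) + 1)))) +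
      1 / 2 * (chainMode (τ + m) (τ + 1) / chainMode (τ + m) τ - 1) +
      1 / 2 * (chainMode (τ + m) (m + 1) / chainMode (τ + m) m - 1) + 1 := by
  obtain ⟨h0, h1⟩ := chainMode_angle (τ + m)
  have hc := chainMode_pos (show τ ≤ τ + m by omega)
  have hs := chainMode_pos (show m ≤ τ + m by omega)
  set θ := Real.pi / (2 * (((τ + m : ℕ) : ℝ) + 1)) with hθ
  set a := θ * (τ + 1 / 2) with ha
  have hb : θ * (m + 1 / 2) = Real.pi / 2 - a := by
    rw [ha, ← h1]; push_cast; ring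
  have e1 : chainMode (τ + m) τ = Real.cos a := rfl
  have e2 : chainMode (τ + m) (τ + 1) = Real.cos (a + θ) := by
    rw [chainMode, ← hθ, ha]; congr 1; push_cast; ring
  have e3 : chainMode (τ + m) m = Real.sin a := by
    rw [chainMode, ← hθ, hb, Real.cos_pi_div_two_sub]
  have e4 : chainMode (τ + m) (m + 1) = Real.sin (a - θ) := by
    rw [chainMode, ← hθ, ← Real.cos_pi_div_two_sub]
    congr 1
    push_cast
    linarith
  rw [e1] at hc
  rw [e3] at hs
  rw [e1, e2, e3, e4, Real.cos_add, Real.sin_sub]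
  -- the claim is that `sin θ ≤ sin (2 a)`, where `θ ≤ 2 a ≤ π - θ`
  have hsin : Real.sin θ ≤ 2 * Real.sin a * Real.cos a := by
    rw [← Real.sin_two_mul]
    have ha2 : 2 * a = θ + 2 * (θ * τ) := by rw [ha]; ring
    have hπ : θ + 2 * (θ * m) + 2 * a = Real.pi := by linarith
    have hτ : 0 ≤ θ * τ := mul_nonneg h0.le (Nat.cast_nonneg _)
    have hm : 0 ≤ θ * m := mul_nonneg h0.le (Nat.cast_nonneg _)
    rcases le_total (2 * a) (Real.pi / 2) with h | h
    · exact Real.sin_le_sin_of_le_of_le_pi_div_two (by linarith [Real.pi_pos]) h (by linarith)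
    · rw [← Real.sin_pi_sub (2 * a)]
      exact Real.sin_le_sin_of_le_of_le_pi_div_two (by linarith [Real.pi_pos]) (by linarith)
        (by linarith)
  have key : (1 - Real.cos θ) + 1 / 2 * ((Real.cos a * Real.cos θ - Real.sin a * Real.sin θ) /
      Real.cos a - 1) + 1 / 2 * ((Real.sin a * Real.cos θ - Real.cos a * Real.sin θ) /
      Real.sin a - 1) + 1 =
      (2 * Real.sin a * Real.cos a - Real.sin θ * (Real.sin a ^ 2 + Real.cos a ^ 2)) /
        (2 * Real.sin a * Real.cos a) := by
    field_simp
    ring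
  rw [key, Real.sin_sq_add_cos_sq, mul_one]
  exact div_nonneg (by linarith) (by positivity)

/-- A path with a unit penalty at any one vertex `τ` has energy at least that of the path with the
penalty at its end. -/
lemma le_sum_norm_sub_sq_add {N τ : ℕ} (hτ : τ ≤ N) (u : ℕ → ℂ) :
    (1 - Real.cos (Real.pi / (2 * (N + 1)))) * ∑ t ∈ Finset.range (N + 1), ‖u t‖ ^ 2 ≤
      ∑ t ∈ Finset.range N, 1 / 2 * ‖u (t + 1) - u t‖ ^ 2 + ‖u τ‖ ^ 2 := by
  obtain ⟨m, rfl⟩ := Nat.exists_eq_add_of_le hτ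
  have h1 := le_sum_norm_sub_sq (show τ ≤ τ + m by omega) u
  have h2 := le_sum_norm_sub_sq (show m ≤ τ + m by omega) fun t => u (τ + m - t)
  have h3 : ∑ t ∈ Finset.range m, 1 / 2 * ‖u (τ + m - (t + 1)) - u (τ + m - t)‖ ^ 2 =
      ∑ t ∈ Finset.range m, 1 / 2 * ‖u (τ + t + 1) - u (τ + t)‖ ^ 2 := by
    rw [← Finset.sum_range_reflect]
    refine Finset.sum_congr rfl fun t ht => ?_
    rw [Finset.mem_range] at ht
    rw [norm_sub_rev, show τ + m - (m - 1 - t) = τ + t + 1 by omega,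
      show τ + m - (m - 1 - t + 1) = τ + t by omega]
  have h4 : ∑ t ∈ Finset.range (m + 1), ‖u (τ + m - t)‖ ^ 2 =
      ∑ t ∈ Finset.range (m + 1), ‖u (τ + t)‖ ^ 2 := by
    rw [← Finset.sum_range_reflect]
    refine Finset.sum_congr rfl fun t ht => ?_
    rw [Finset.mem_range] at ht
    rw [show τ + m - (m + 1 - 1 - t) = τ + t by omega]
  rw [h3, h4, Nat.add_sub_cancel, Finset.sum_range_succ'] at h2
  rw [Finset.sum_range_succ] at h1
  rw [add_assoc τ m 1, Finset.sum_range_add (fun t => ‖u t‖ ^ 2),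
    Finset.sum_range_add (fun t => 1 / 2 * ‖u (t + 1) - u t‖ ^ 2), Finset.sum_range_succ' _ m]
  have h5 := mul_nonneg (chainMode_slopes τ m) (sq_nonneg ‖u τ‖)
  simp only [add_zero, ← add_assoc] at h1 h2 h5 ⊢
  linarith

end Chain

/-! ### Projectors with nearly orthogonal ranges -/

section Projectors

/-- If `a` and `b` are the images of `v` under two projectors whose ranges are nearly orthogonal,
then `v` cannot be close to both ranges. -/
lemma norm_sq_add_norm_sq_le {E : Type*} [NormedAddCommGroup E] [InnerProductSpace ℂ E] {v a b : E}
    {s : ℝ} (hs : 0 ≤ s) (ha : (inner ℂ v a).re = ‖a‖ ^ 2) (hb : (inner ℂ v b).re = ‖b‖ ^ 2)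
    (hab : (inner ℂ a b).re ≤ s * (‖a‖ * ‖b‖)) : ‖a‖ ^ 2 + ‖b‖ ^ 2 ≤ (1 + s) * ‖v‖ ^ 2 := by
  set x := ‖a‖ ^ 2 + ‖b‖ ^ 2 with hx
  have hx0 : 0 ≤ x := by positivity
  have h1 : x ≤ ‖v‖ * ‖a + b‖ := by
    calc x = (inner ℂ v (a + b)).re := by rw [inner_add_right, Complex.add_re, ha, hb]
      _ ≤ ‖inner ℂ v (a + b)‖ := Complex.re_le_norm _
      _ ≤ _ := norm_inner_le_norm _ _
  have h2 : ‖a + b‖ ^ 2 ≤ (1 + s) * x := by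
    have h3 : ‖a + b‖ ^ 2 = ‖a‖ ^ 2 + 2 * (inner ℂ a b).re + ‖b‖ ^ 2 := norm_add_sq (𝕜 := ℂ) a b
    have h4 : 0 ≤ s * (‖a‖ - ‖b‖) ^ 2 := mul_nonneg hs (sq_nonneg _)
    rw [h3, hx]
    linarith
  rcases hx0.eq_or_lt with h | h
  · rw [← h]; positivity
  · have h5 : x ^ 2 ≤ ‖v‖ ^ 2 * ((1 + s) * x) := by
      calc x ^ 2 ≤ (‖v‖ * ‖a + b‖) ^ 2 := pow_le_pow_left₀ hx0 h1 2
        _ = ‖v‖ ^ 2 * ‖a + b‖ ^ 2 := mul_pow _ _ 2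
        _ ≤ _ := mul_le_mul_of_nonneg_left h2 (sq_nonneg _)
    refine le_of_mul_le_mul_right ?_ h
    linarith

end Projectors

/-! ### Acceptance probabilities -/

namespace Verifier

section Euclidean

variable {n : Type*} [Fintype n]

lemma norm_toLp_sq (a : n → ℂ) : ‖WithLp.toLp 2 a‖ ^ 2 = sqNorm a := by
  rw [EuclideanSpace.norm_sq_eq]; rfl

lemma inner_toLp (a b : n → ℂ) :
    inner ℂ (WithLp.toLp 2 a) (WithLp.toLp 2 b) = star a ⬝ᵥ b := by
  rw [EuclideanSpace.inner_toLp_toLp, dotProduct_comm]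

end Euclidean

variable {n : Type*} [Fintype n] [DecidableEq n] (V : Verifier n)

lemma star_one_sub_reject_mulVec_dotProduct (φ χ : n → ℂ) :
    star ((1 - V.reject).mulVec φ) ⬝ᵥ χ = star φ ⬝ᵥ (1 - V.reject).mulVec χ := by
  rw [star_mulVec_dotProduct, Matrix.conjTranspose_sub, Matrix.conjTranspose_one,
    V.reject_isHermitian.eq]

lemma star_dotProduct_one_sub_reject_mulVec (φ χ : n → ℂ) :
    star φ ⬝ᵥ (1 - V.reject).mulVec χ =
      star ((1 - V.reject).mulVec φ) ⬝ᵥ (1 - V.reject).mulVec χ := by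
  have h : (1 - V.reject) * (1 - V.reject) = 1 - V.reject := by
    rw [sub_mul, mul_sub, mul_sub, V.reject_mul_self]
    simp
  rw [star_one_sub_reject_mulVec_dotProduct, Matrix.mulVec_mulVec, h]

lemma acceptProb_nonneg (ψ : n → ℂ) : 0 ≤ V.acceptProb ψ := sqNorm_nonneg _

lemma star_dotProduct_reject_mulVec (ψ : n → ℂ) :
    star ((V.evolution : Matrix n n ℂ).mulVec ψ) ⬝ᵥ
        V.reject.mulVec ((V.evolution : Matrix n n ℂ).mulVec ψ) =
      ((sqNorm ψ - V.acceptProb ψ : ℝ) : ℂ) := by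
  have h := V.star_dotProduct_one_sub_reject_mulVec
    ((V.evolution : Matrix n n ℂ).mulVec ψ) ((V.evolution : Matrix n n ℂ).mulVec ψ)
  rw [acceptProb, Complex.ofReal_sub, ofReal_sqNorm ((1 - V.reject).mulVec _), ← h,
    Matrix.sub_mulVec, Matrix.one_mulVec, dotProduct_sub, ← ofReal_sqNorm,
    sqNorm_mulVec V.evolution.2, sub_sub_cancel]

lemma acceptProb_smul (c : ℂ) (ψ : n → ℂ) : V.acceptProb (c • ψ) = ‖c‖ ^ 2 * V.acceptProb ψ := by
  rw [acceptProb, Matrix.mulVec_smul, Matrix.mulVec_smul, sqNorm_smul, acceptProb]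

lemma exists_normalised {ψ : n → ℂ} (hψ : ψ ∈ V.inputs) (h0 : ψ ≠ 0) :
    ∃ c : ℂ, c • ψ ∈ V.inputs ∧ ‖c‖ ^ 2 * sqNorm ψ = 1 := by
  have hpos := sqNorm_pos h0
  refine ⟨((Real.sqrt (sqNorm ψ))⁻¹ : ℝ), V.inputs.smul_mem _ hψ, ?_⟩
  rw [Complex.norm_real, Real.norm_eq_abs, sq_abs, inv_pow, Real.sq_sqrt hpos.le,
    inv_mul_cancel₀ hpos.ne']

lemma exists_input : ∃ ψ ∈ V.inputs, sqNorm ψ = 1 := by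
  obtain ⟨ψ, hψ, h0⟩ := V.inputs.exists_mem_ne_zero_of_ne_bot V.inputs_ne_bot
  obtain ⟨c, hc, h1⟩ := V.exists_normalised hψ h0
  exact ⟨c • ψ, hc, by rw [sqNorm_smul, h1]⟩

variable {V}

lemma IsNo.acceptProb_le {η : ℝ} (h : V.IsNo η) {ψ : n → ℂ} (hψ : ψ ∈ V.inputs) :
    V.acceptProb ψ ≤ η * sqNorm ψ := by
  rcases eq_or_ne ψ 0 with rfl | h0
  · simp [acceptProb, sqNorm]
  · obtain ⟨c, hc, h1⟩ := V.exists_normalised hψ h0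
    have h2 := h _ hc (by rw [sqNorm_smul, h1])
    rw [acceptProb_smul] at h2
    have h3 := mul_le_mul_of_nonneg_right h2 (sqNorm_nonneg ψ)
    have h4 : ‖c‖ ^ 2 * V.acceptProb ψ * sqNorm ψ = V.acceptProb ψ := by
      rw [mul_right_comm, h1, one_mul]
    rwa [h4] at h3

/-- On a NO instance, the accepted states are nearly orthogonal to the inputs; here `b` is the
orthogonal projection of `u` to the inputs. -/
lemma IsNo.acceptProb_add_sqNorm_le {η : ℝ} (h : V.IsNo η) {u b : n → ℂ} (hb : b ∈ V.inputs)
    (hub : star u ⬝ᵥ b = (sqNorm b : ℂ)) :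
    V.acceptProb u + sqNorm b ≤ (1 + Real.sqrt η) * sqNorm u := by
  set E := (V.evolution : Matrix n n ℂ) with hE
  set a := E.conjTranspose.mulVec ((1 - V.reject).mulVec (E.mulVec u)) with ha
  have hEc : E.conjTranspose ∈ Matrix.unitaryGroup n ℂ := (star V.evolution).2
  have hna : sqNorm a = V.acceptProb u := sqNorm_mulVec hEc _
  have hua : star u ⬝ᵥ a = (sqNorm a : ℂ) := by
    rw [hna, acceptProb, ofReal_sqNorm, ← star_dotProduct_one_sub_reject_mulVec,
      star_mulVec_dotProduct]
  have hab : star a ⬝ᵥ b = star ((1 - V.reject).mulVec (E.mulVec u)) ⬝ᵥ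
      (1 - V.reject).mulVec (E.mulVec b) := by
    rw [ha, star_mulVec_dotProduct, Matrix.conjTranspose_conjTranspose,
      star_one_sub_reject_mulVec_dotProduct, star_dotProduct_one_sub_reject_mulVec]
  rw [← hna, ← norm_toLp_sq, ← norm_toLp_sq, ← norm_toLp_sq]
  refine norm_sq_add_norm_sq_le (Real.sqrt_nonneg η) ?_ ?_ ?_
  · rw [inner_toLp, hua, Complex.ofReal_re, norm_toLp_sq]
  · rw [inner_toLp, hub, Complex.ofReal_re, norm_toLp_sq]
  · have hnorm : ∀ x : n → ℂ, ‖WithLp.toLp 2 x‖ = Real.sqrt (sqNorm x) := fun x => by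
      rw [← norm_toLp_sq, Real.sqrt_sq (norm_nonneg _)]
    rw [inner_toLp, hab, ← inner_toLp]
    refine (Complex.re_le_norm _).trans ((norm_inner_le_norm _ _).trans ?_)
    rw [hnorm, hnorm, hnorm, hnorm, hna, mul_left_comm]
    refine mul_le_mul_of_nonneg_left ?_ (Real.sqrt_nonneg _)
    rw [← Real.sqrt_mul' _ (sqNorm_nonneg b)]
    exact Real.sqrt_le_sqrt (h.acceptProb_le hb)

end Verifier

namespace StandardForm

/-! ### All-legal cells as paths -/

section Timeline

variable {L : ℕ} {C Q : Type*} [Fintype Q] [DecidableEq Q]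

/-- The product `G (t - 1) * ⋯ * G 0`. -/
def gateProd {n : Type*} [Fintype n] [DecidableEq n] (G : ℕ → Matrix n n ℂ) : ℕ → Matrix n n ℂ
  | 0 => 1
  | t + 1 => G t * gateProd G t

/-- The states of `S` are `f 0, …, f N`, the only transitions among them are those from `f t` to
`f (t + 1)`, and `G t` is the associated unitary. -/
structure IsTimeline (H : StandardForm C Q) (S : Set (Fin L → C)) (N : ℕ) (f : ℕ → Fin L → C)
    (G : ℕ → Matrix (Fin L → Q) (Fin L → Q) ℂ) : Prop where
  isInitial : H.IsInitial (f 0)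
  isFinal : H.IsFinal (f N)
  step : ∀ t < N, H.StepVia (f t) (f (t + 1)) (G t)
  injOn : Set.InjOn f (Set.Iic N)
  image_eq : f '' Set.Iic N = S

variable {H : StandardForm C Q} {S : Set (Fin L → C)}

lemma IsInitial.not_stepVia {k k' : Fin L → C} {G : Matrix (Fin L → Q) (Fin L → Q) ℂ}
    (hk : H.IsInitial k) : ¬ H.StepVia k' k G := by
  rintro ⟨i, U, hU, -⟩
  rw [hk] at hU
  cases hU

lemma IsFinal.not_stepVia {k k' : Fin L → C} {G : Matrix (Fin L → Q) (Fin L → Q) ℂ}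
    (hk : H.IsFinal k) : ¬ H.StepVia k k' G := by
  rintro ⟨i, U, hU, -⟩
  rw [hk] at hU
  cases hU

lemma StepVia.right_unique {k k' k'' : Fin L → C} {G G' : Matrix (Fin L → Q) (Fin L → Q) ℂ}
    (hk : {p : Fin (L - 1) × (C × C) | H.trans (pairAt k p.1) p.2 ≠ none}.Subsingleton)
    (h : H.StepVia k k' G) (h' : H.StepVia k k'' G') : k' = k'' := by
  obtain ⟨i, s, U, hU, rfl, -⟩ := h.exists_eq_splice
  obtain ⟨i', s', U', hU', rfl, -⟩ := h'.exists_eq_splice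
  have := @hk (i, s) (by simp [hU]) (i', s') (by simp [hU'])
  rw [Prod.mk.injEq] at this
  rw [this.1, this.2]

lemma StepVia.left_unique {k k' k'' : Fin L → C} {G G' : Matrix (Fin L → Q) (Fin L → Q) ℂ}
    (hk : {p : Fin (L - 1) × (C × C) | H.trans p.2 (pairAt k p.1) ≠ none}.Subsingleton)
    (h : H.StepVia k' k G) (h' : H.StepVia k'' k G') : k' = k'' := by
  obtain ⟨i, s, U, hU, rfl, -⟩ := h.exists_splice_eq
  obtain ⟨i', s', U', hU', rfl, -⟩ := h'.exists_splice_eq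
  have := @hk (i, s) (by simp [hU]) (i', s') (by simp [hU'])
  rw [Prod.mk.injEq] at this
  rw [this.1, this.2]

lemma Evolves.exists_seq {k k' : Fin L → C} {n : ℕ} {F : Matrix (Fin L → Q) (Fin L → Q) ℂ}
    (h : H.Evolves k n F k') : ∃ (f : ℕ → Fin L → C) (G : ℕ → Matrix (Fin L → Q) (Fin L → Q) ℂ),
      f 0 = k ∧ f n = k' ∧ ∀ t < n, H.StepVia (f t) (f (t + 1)) (G t) := by
  induction h with
  | refl => exact ⟨fun _ => k, fun _ => 1, rfl, rfl, by simp⟩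
  | @step n F G₁ k' k'' _ hs ih =>
    obtain ⟨f, G, h0, hn, hstep⟩ := ih
    refine ⟨Function.update f (n + 1) k'', Function.update G n G₁, ?_, ?_, ?_⟩
    · rw [Function.update_of_ne (by omega), h0]
    · rw [Function.update_self]
    · intro t ht
      rw [Function.update_of_ne (show t ≠ n + 1 by omega)]
      rcases (Nat.lt_succ_iff.1 ht).eq_or_lt with rfl | ht'
      · rw [Function.update_self, Function.update_self, hn]
        exact hs
      · rw [Function.update_of_ne (by omega), Function.update_of_ne (by omega)]
        exact hstep t ht'

variable {Tinit : ℕ}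

/-- An all-legal cell is a path from a state without backwards transition to a state without
forwards transition. -/
lemma IsStandardFormClock.exists_isTimeline (hclock : H.IsStandardFormClock L Tinit)
    (hS : H.IsCell S) (hleg : ∀ k ∈ S, H.Legal k) : ∃ N f G, H.IsTimeline S N f G := by
  obtain ⟨W, hlegW, hW, hsub⟩ := hclock.exists_wellFormed
  obtain ⟨⟨k₀, hk₀, hini⟩, k₁, hk₁, hfin⟩ := hclock.exists_ends S hS hleg
  have hSW : ∀ k ∈ S, k ∈ W := fun k hk => hlegW k (hleg k hk)
  have hcl := hS.1.2
  -- the states reached from `k₀` are closed under the transition rules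
  have hreach : ∀ k ∈ S, k ∈ S ∧ ∃ n F, H.Evolves k₀ n F k := by
    refine hS.subset_of_mem (W := {k | k ∈ S ∧ ∃ n F, H.Evolves k₀ n F k}) ?_ hk₀
      ⟨hk₀, 0, 1, Evolves.refl⟩
    intro k k' G hstep
    constructor
    · rintro ⟨hk, n, F, h⟩
      exact ⟨(hcl _ _ _ hstep).1 hk, n + 1, _, h.step hstep⟩
    · rintro ⟨hk, n, F, h⟩
      refine ⟨(hcl _ _ _ hstep).2 hk, ?_⟩
      cases h with
      | refl => exact absurd hstep hini.not_stepVia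
      | @step n F G' k'' _ h hs =>
        rw [hstep.left_unique (hsub k' (hSW k' hk)).2 hs]
        exact ⟨n, F, h⟩
  obtain ⟨-, N, F, hN⟩ := hreach k₁ hk₁
  obtain ⟨f, G, rfl, rfl, hstep⟩ := hN.exists_seq
  have hfS : ∀ t ≤ N, f t ∈ S := by
    intro t
    induction t with
    | zero => exact fun _ => hk₀
    | succ t ih => exact fun ht => (hcl _ _ _ (hstep t ht)).1 (ih (by omega))
  refine ⟨N, f, G, hini, hfin, hstep, ?_, ?_⟩
  · have hne : ∀ s t, s < t → t ≤ N → f s ≠ f t := by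
      intro s
      induction s with
      | zero =>
        intro t hst ht h
        obtain ⟨t, rfl⟩ := Nat.exists_eq_succ_of_ne_zero hst.ne'
        exact hini.not_stepVia (h ▸ hstep t ht)
      | succ s ih =>
        intro t hst ht h
        obtain ⟨t, rfl⟩ := Nat.exists_eq_succ_of_ne_zero (show t ≠ 0 by omega)
        refine ih t (by omega) (by omega) ?_
        have h1 := hstep s (by omega)
        rw [h] at h1
        exact h1.left_unique (hsub _ (hSW _ (hfS _ ht))).2 (hstep t (by omega))
    intro s hs t ht h
    rcases lt_trichotomy s t with hst | hst | hst
    · exact absurd h (hne s t hst ht)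
    · exact hst
    · exact absurd h.symm (hne t s hst hs)
  · refine Set.Subset.antisymm (Set.image_subset_iff.2 fun t ht => hfS t ht) ?_
    refine hS.subset_of_mem ?_ hk₀ ⟨0, Nat.zero_le N, rfl⟩
    intro k k' G' hs
    constructor
    · rintro ⟨t, ht, rfl⟩
      rcases (Set.mem_Iic.1 ht).eq_or_lt with rfl | ht'
      · exact absurd hs hfin.not_stepVia
      · exact ⟨t + 1, ht', (hstep t ht').right_unique (hsub _ (hSW _ (hfS t ht))).1 hs⟩
    · rintro ⟨t, ht, rfl⟩
      rcases t with _ | t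
      · exact absurd hs hini.not_stepVia
      · exact ⟨t, Nat.le_of_succ_le ht,
          (hstep t ht).left_unique (hsub _ (hSW _ (hfS _ ht))).2 hs⟩

namespace IsTimeline

variable {N : ℕ} {f : ℕ → Fin L → C} {G : ℕ → Matrix (Fin L → Q) (Fin L → Q) ℂ}

lemma mem (h : H.IsTimeline S N f G) {t : ℕ} (ht : t ≤ N) : f t ∈ S :=
  h.image_eq ▸ ⟨t, ht, rfl⟩

lemma ncard (h : H.IsTimeline S N f G) : S.ncard = N + 1 := by
  rw [← h.image_eq, h.injOn.ncard_image, ← Finset.coe_Iic, Set.ncard_coe_finset,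
    Nat.card_Iic]

lemma evolves (h : H.IsTimeline S N f G) {t : ℕ} (ht : t ≤ N) :
    H.Evolves (f 0) t (gateProd G t) (f t) := by
  induction t with
  | zero => exact Evolves.refl
  | succ t ih => exact (ih (by omega)).step (h.step t ht)

lemma gateProd_mem (h : H.IsTimeline S N f G) {t : ℕ} (ht : t ≤ N) :
    gateProd G t ∈ Matrix.unitaryGroup (Fin L → Q) ℂ := by
  induction t with
  | zero => exact one_mem _
  | succ t ih => exact mul_mem (h.step t ht).mem_unitaryGroup (ih (by omega))

lemma not_isFinal (h : H.IsTimeline S N f G) {t : ℕ} (ht : t < N) : ¬ H.IsFinal (f t) :=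
  fun h' => h'.not_stepVia (h.step t ht)

lemma sum_eq [Fintype C] {M : Type*} [AddCommMonoid M] (h : H.IsTimeline S N f G)
    (g : (Fin L → C) → M) (hg : ∀ k ∉ S, g k = 0) :
    ∑ k, g k = ∑ t ∈ Finset.range (N + 1), g (f t) := by
  classical
  have hinj : Set.InjOn f (Finset.range (N + 1)) := by
    intro s hs t ht
    exact h.injOn (by simpa [Nat.lt_succ_iff] using hs) (by simpa [Nat.lt_succ_iff] using ht)
  rw [← Finset.sum_image hinj]
  refine (Finset.sum_subset (Finset.subset_univ _) fun k _ hk => hg k fun hkS => hk ?_).symm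
  rw [← h.image_eq] at hkS
  obtain ⟨t, ht, rfl⟩ := hkS
  exact Finset.mem_image_of_mem f (Finset.mem_range.2 (Nat.lt_succ_of_le ht))

lemma gateProd_eq_one (h : H.IsTimeline S N f G) (hclock : H.IsStandardFormClock L Tinit)
    (hS : H.IsCell S) (hleg : ∀ k ∈ S, H.Legal k) {t : ℕ} (ht : t ≤ N) (ht' : t ≤ Tinit) :
    gateProd G t = 1 := by
  induction t with
  | zero => rfl
  | succ t ih =>
    rw [gateProd, ih (by omega) (by omega), mul_one]
    exact hclock.init_trivial S hS hleg _ (h.mem (Nat.zero_le N)) h.isInitial t _ _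
      (h.evolves (show t ≤ N by omega)) (by omega) _ _ (h.step t ht)

/-- The input penalty is nonzero only before the computation proper starts. -/
lemma gateProd_eq_one_of_inCount (h : H.IsTimeline S N f G)
    (hclock : H.IsStandardFormClock L Tinit) (hS : H.IsCell S) (hleg : ∀ k ∈ S, H.Legal k)
    {t : ℕ} (ht : t ≤ N) {q : Fin L → Q} (hq : H.inCount (f t) q ≠ 0) : gateProd G t = 1 := by
  refine h.gateProd_eq_one hclock hS hleg ht ?_
  obtain ⟨i, hi⟩ := exists_mem_inPen hq
  exact hclock.init_detected S hS hleg _ (h.mem (Nat.zero_le N)) h.isInitial t _ _ (h.evolves ht)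
    ⟨i, _, hi⟩

end IsTimeline

end Timeline

end StandardForm

namespace StandardForm

/-! ### The energy of all-legal cells -/

section LegalCells

variable {L : ℕ} {C Q : Type*} [Fintype Q] [DecidableEq Q] {H : StandardForm C Q}
  {S : Set (Fin L → C)} {Tinit N : ℕ} {f : ℕ → Fin L → C}
  {G : ℕ → Matrix (Fin L → Q) (Fin L → Q) ℂ}

namespace IsTimeline

lemma outCount_eq_zero (h : H.IsTimeline S N f G) (hclock : H.IsStandardFormClock L Tinit)
    (hS : H.IsCell S) (hleg : ∀ k ∈ S, H.Legal k) {t : ℕ} (ht : t < N) (q : Fin L → Q) :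
    H.outCount (f t) q = 0 :=
  Finset.sum_eq_zero fun i _ => if_neg fun h' =>
    (hclock.final_detected S hS hleg _ (h.mem ht.le)).2 (h.not_isFinal ht) i h'.1

variable [Fintype C]

lemma transEnergy_eq (h : H.IsTimeline S N f G) (hclock : H.IsStandardFormClock L Tinit)
    (hS : H.IsCell S) (hleg : ∀ k ∈ S, H.Legal k) {v : (Fin L → C) × (Fin L → Q) → ℂ}
    (hv : ∀ x, x.1 ∉ S → v x = 0) :
    H.transEnergy v = ∑ t ∈ Finset.range N,
      1 / 2 * sqNorm (slice v (f (t + 1)) - (G t).mulVec (slice v (f t))) := by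
  obtain ⟨W, hlegW, hW, hsub⟩ := hclock.exists_wellFormed
  rw [transEnergy, Finset.sum_comm, h.sum_eq, Finset.sum_range_succ]
  · rw [add_eq_left.2]
    · refine Finset.sum_congr rfl fun t ht => ?_
      rw [Finset.mem_range] at ht
      obtain ⟨i, cd, U, hU, hk, hG⟩ := (h.step t ht).exists_eq_splice
      rw [← Fintype.sum_prod_type', sum_elim_eq_of_subsingleton (p := (i, cd))
        (hsub _ (hlegW _ (hleg _ (h.mem ht.le)))).1 _ hU, hk, hG]
    · exact Finset.sum_eq_zero fun i _ => Finset.sum_eq_zero fun cd _ => by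
        rw [h.isFinal i cd, Option.elim_none]
  · intro k hk
    refine Finset.sum_eq_zero fun i _ => Finset.sum_eq_zero fun cd _ => ?_
    cases hU : H.trans (pairAt k i) cd with
    | none => rfl
    | some U =>
      rw [Option.elim_some, slice_eq_zero hv hk,
        slice_eq_zero hv fun h' => hk ((hS.1.2 _ _ _ (stepVia_splice hU)).2 h'), Matrix.mulVec_zero, sub_zero, sqNorm_eq_zero.2 rfl, mul_zero]

lemma penaltyEnergy_eq (h : H.IsTimeline S N f G) (hclock : H.IsStandardFormClock L Tinit)
    (hS : H.IsCell S) (hleg : ∀ k ∈ S, H.Legal k) {v : (Fin L → C) × (Fin L → Q) → ℂ}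
    (hv : ∀ x, x.1 ∉ S → v x = 0) :
    H.penaltyEnergy v =
      ∑ t ∈ Finset.range (N + 1), ∑ q, H.inCount (f t) q * ‖v (f t, q)‖ ^ 2 +
        ∑ q, H.outCount (f N) q * ‖v (f N, q)‖ ^ 2 := by
  rw [penaltyEnergy, h.sum_eq _ fun k hk => Finset.sum_eq_zero fun q _ => by simp [hv (k, q) hk]]
  have h1 : ∀ t ∈ Finset.range (N + 1), ∑ q, (H.penCount (f t) + H.inCount (f t) q +
      H.outCount (f t) q) * ‖v (f t, q)‖ ^ 2 = ∑ q, H.inCount (f t) q * ‖v (f t, q)‖ ^ 2 +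
        ∑ q, H.outCount (f t) q * ‖v (f t, q)‖ ^ 2 := by
    intro t ht
    rw [← Finset.sum_add_distrib, penCount_eq_zero (hleg _ (h.mem (Finset.mem_range_succ_iff.1 ht)))]
    exact Finset.sum_congr rfl fun q _ => by ring
  rw [Finset.sum_congr rfl h1, Finset.sum_add_distrib, Finset.sum_range_succ (fun t =>
    ∑ q, H.outCount (f t) q * ‖v (f t, q)‖ ^ 2), Finset.sum_eq_zero (s := Finset.range N), zero_add]
  intro t ht
  exact Finset.sum_eq_zero fun q _ => by
    rw [h.outCount_eq_zero hclock hS hleg (Finset.mem_range.1 ht), zero_mul]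

variable [DecidableEq C] {V : Verifier (Fin L → Q)}

lemma mem_inputs_iff (h : H.IsTimeline S N f G) (hV : H.Encodes V) (hS : H.IsCell S)
    (hleg : ∀ k ∈ S, H.Legal k) {ψ : (Fin L → Q) → ℂ} :
    ψ ∈ V.inputs ↔ ∀ t ≤ N, ∀ q, H.inCount (f t) q ≠ 0 → ψ q = 0 := by
  rw [(hV S hS hleg).1 ψ, ← h.image_eq, Set.forall_mem_image]
  refine forall₂_congr fun t ht => ?_
  rw [HIn_eq, funext_iff]
  constructor
  · intro h' q hq
    have := h' (f t, q)
    simpa [Matrix.mulVec_diagonal, ket, hq] using this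
  · rintro h' ⟨k, q⟩
    by_cases hk : k = f t
    · by_cases hq : H.inCount k q = 0
      · simp [Matrix.mulVec_diagonal, hq]
      · simp [Matrix.mulVec_diagonal, ket, hk, h' q (hk ▸ hq)]
    · simp [Matrix.mulVec_diagonal, ket, hk]

lemma gateProd_last (h : H.IsTimeline S N f G) (hV : H.Encodes V) (hS : H.IsCell S)
    (hleg : ∀ k ∈ S, H.Legal k) :
    gateProd G N = (V.evolution : Matrix (Fin L → Q) (Fin L → Q) ℂ) :=
  (hV S hS hleg).2.1 _ (h.mem (Nat.zero_le N)) _ (h.mem le_rfl) h.isInitial h.isFinal _ _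
    (h.evolves le_rfl)

/-- The output penalty of a final state is the probability of rejection. -/
lemma sum_outCount (h : H.IsTimeline S N f G) (hV : H.Encodes V) (hS : H.IsCell S)
    (hleg : ∀ k ∈ S, H.Legal k) (ψ : (Fin L → Q) → ℂ) :
    ∑ q, H.outCount (f N) q * ‖(gateProd G N).mulVec ψ q‖ ^ 2 = sqNorm ψ - V.acceptProb ψ := by
  have h1 := (hV S hS hleg).2.2 _ (h.mem le_rfl) h.isFinal ((gateProd G N).mulVec ψ)
  rw [HOut_eq] at h1
  have h2 : V.reject.mulVec ((gateProd G N).mulVec ψ) = (Matrix.diagonal fun q =>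
      (H.outCount (f N) q : ℂ)).mulVec ((gateProd G N).mulVec ψ) := by
    funext q
    have := congrFun h1 (f N, q)
    simp only [Matrix.mulVec_diagonal, ket, if_true] at this
    rw [Matrix.mulVec_diagonal, this]
  have h3 := V.star_dotProduct_reject_mulVec ψ
  rw [← h.gateProd_last hV hS hleg, h2, mulVec_diagonal_expectation] at h3
  exact_mod_cast h3

/-- The history state of the input `ψ` with the amplitudes `c`. -/
lemma exists_historyState (h : H.IsTimeline S N f G) (hclock : H.IsStandardFormClock L Tinit)
    (hV : H.Encodes V) (hS : H.IsCell S) (hleg : ∀ k ∈ S, H.Legal k) (c : ℕ → ℝ)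
    {ψ : (Fin L → Q) → ℂ} (hψ : ψ ∈ V.inputs) (hnorm : sqNorm ψ = 1) :
    ∃ v : (Fin L → C) × (Fin L → Q) → ℂ, (∀ x, x.1 ∉ S → v x = 0) ∧
      sqNorm v = ∑ t ∈ Finset.range (N + 1), c t ^ 2 ∧
      H.transEnergy v + H.penaltyEnergy v =
        ∑ t ∈ Finset.range N, 1 / 2 * (c (t + 1) - c t) ^ 2 + c N ^ 2 * (1 - V.acceptProb ψ) := by
  let v : (Fin L → C) × (Fin L → Q) → ℂ := fun x => ∑ t ∈ Finset.range (N + 1),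
    if x.1 = f t then (c t : ℂ) * (gateProd G t).mulVec ψ x.2 else 0
  have hv : ∀ x, x.1 ∉ S → v x = 0 := fun x hx => Finset.sum_eq_zero fun t ht =>
    if_neg fun h' : x.1 = f t => hx (h'.symm ▸ h.mem (Finset.mem_range_succ_iff.1 ht))
  have hsl : ∀ t ≤ N, slice v (f t) = (c t : ℂ) • (gateProd G t).mulVec ψ := by
    intro t ht
    funext q
    change ∑ s ∈ Finset.range (N + 1), (if f t = f s then _ else _) = _
    rw [Finset.sum_eq_single t]
    · simp
    · intro s hs hne
      exact if_neg fun h' => hne (h.injOn (Finset.mem_range_succ_iff.1 hs) ht h'.symm)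
    · intro h'
      exact absurd (Finset.mem_range_succ_iff.2 ht) h'
  have habs : ∀ x : ℝ, ‖(x : ℂ)‖ ^ 2 = x ^ 2 := fun x => by
    rw [Complex.norm_real, Real.norm_eq_abs, sq_abs]
  refine ⟨v, hv, ?_, ?_⟩
  · rw [sqNorm_eq_sum_slice, h.sum_eq _ fun k hk => sqNorm_slice_eq_zero hv hk]
    refine Finset.sum_congr rfl fun t ht => ?_
    rw [Finset.mem_range_succ_iff] at ht
    rw [hsl t ht, sqNorm_smul, sqNorm_mulVec (h.gateProd_mem ht), hnorm, habs, mul_one]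
  · rw [h.transEnergy_eq hclock hS hleg hv, h.penaltyEnergy_eq hclock hS hleg hv]
    have h1 : ∀ t ∈ Finset.range N,
        1 / 2 * sqNorm (slice v (f (t + 1)) - (G t).mulVec (slice v (f t))) =
          1 / 2 * (c (t + 1) - c t) ^ 2 := by
      intro t ht
      rw [Finset.mem_range] at ht
      rw [hsl t ht.le, hsl (t + 1) ht, Matrix.mulVec_smul, Matrix.mulVec_mulVec, ← gateProd,
        ← sub_smul, sqNorm_smul, sqNorm_mulVec (h.gateProd_mem ht), hnorm, ← Complex.ofReal_sub,
        habs, mul_one]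
    have h2 : ∀ t ∈ Finset.range (N + 1), ∑ q, H.inCount (f t) q * ‖v (f t, q)‖ ^ 2 = 0 := by
      intro t ht
      rw [Finset.mem_range_succ_iff] at ht
      refine Finset.sum_eq_zero fun q _ => ?_
      by_cases hq : H.inCount (f t) q = 0
      · rw [hq, zero_mul]
      · have h3 : v (f t, q) = (c t : ℂ) * (gateProd G t).mulVec ψ q := congrFun (hsl t ht) q
        rw [h3, h.gateProd_eq_one_of_inCount hclock hS hleg ht hq, Matrix.one_mulVec,
          (h.mem_inputs_iff hV hS hleg).1 hψ t ht q hq]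
        simp
    have h4 : ∑ q, H.outCount (f N) q * ‖v (f N, q)‖ ^ 2 = c N ^ 2 * (1 - V.acceptProb ψ) := by
      rw [← hnorm, ← h.sum_outCount hV hS hleg, Finset.mul_sum]
      refine Finset.sum_congr rfl fun q _ => ?_
      have h3 : v (f N, q) = (c N : ℂ) * (gateProd G N).mulVec ψ q := congrFun (hsl N le_rfl) q
      rw [h3, norm_mul, mul_pow, habs]
      ring
    rw [Finset.sum_congr rfl h1, Finset.sum_congr rfl h2, h4, Finset.sum_const_zero, zero_add]

/-- The lower bound for NO instances. In the rotating frame `u t = (gateProd G t)ᴴ v_t` the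
transition terms become the Laplacian of a path, and each basis state of the quantum register is
penalised somewhere on the path: wrong inputs by the input penalty, and inputs by the output penalty
up to an error of `√η`. -/
lemma le_energy_of_isNo (h : H.IsTimeline S N f G) (hclock : H.IsStandardFormClock L Tinit)
    (hV : H.Encodes V) (hS : H.IsCell S) (hleg : ∀ k ∈ S, H.Legal k) {η : ℝ} (hNo : V.IsNo η)
    {v : (Fin L → C) × (Fin L → Q) → ℂ} (hv : ∀ x, x.1 ∉ S → v x = 0) :
    (1 - Real.cos (Real.pi / (2 * (N + 1))) - Real.sqrt η) * sqNorm v ≤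
      H.transEnergy v + H.penaltyEnergy v := by
  classical
  obtain ⟨u, hu⟩ : ∃ u : ℕ → (Fin L → Q) → ℂ,
      u = fun t => (gateProd G t).conjTranspose.mulVec (slice v (f t)) := ⟨_, rfl⟩
  have hvu : ∀ t ≤ N, slice v (f t) = (gateProd G t).mulVec (u t) := by
    intro t ht
    rw [hu, Matrix.mulVec_mulVec, ← Matrix.star_eq_conjTranspose,
      Matrix.mem_unitaryGroup_iff.1 (h.gateProd_mem ht), Matrix.one_mulVec]
  have hnorm : sqNorm v = ∑ t ∈ Finset.range (N + 1), sqNorm (u t) := by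
    rw [sqNorm_eq_sum_slice, h.sum_eq _ fun k hk => sqNorm_slice_eq_zero hv hk]
    refine Finset.sum_congr rfl fun t ht => ?_
    rw [Finset.mem_range_succ_iff] at ht
    rw [hvu t ht, sqNorm_mulVec (h.gateProd_mem ht)]
  have htrans : H.transEnergy v = ∑ t ∈ Finset.range N, 1 / 2 * sqNorm (u (t + 1) - u t) := by
    rw [h.transEnergy_eq hclock hS hleg hv]
    refine Finset.sum_congr rfl fun t ht => ?_
    rw [Finset.mem_range] at ht
    rw [hvu t ht.le, hvu (t + 1) ht, Matrix.mulVec_mulVec, ← gateProd, ← Matrix.mulVec_sub,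
      sqNorm_mulVec (h.gateProd_mem ht)]
  have hin : ∀ t ∈ Finset.range (N + 1), ∑ q, H.inCount (f t) q * ‖v (f t, q)‖ ^ 2 =
      ∑ q, H.inCount (f t) q * ‖u t q‖ ^ 2 := by
    intro t ht
    rw [Finset.mem_range_succ_iff] at ht
    refine Finset.sum_congr rfl fun q _ => ?_
    by_cases hq : H.inCount (f t) q = 0
    · rw [hq, zero_mul, zero_mul]
    · have h3 : v (f t, q) = (gateProd G t).mulVec (u t) q := congrFun (hvu t ht) q
      rw [h3, h.gateProd_eq_one_of_inCount hclock hS hleg ht hq, Matrix.one_mulVec]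
  -- the projection of the final state, in the rotating frame, to the inputs
  set b : (Fin L → Q) → ℂ := fun q => if ∀ t ≤ N, H.inCount (f t) q = 0 then u N q else 0 with hb
  have hbin : b ∈ V.inputs := by
    rw [h.mem_inputs_iff hV hS hleg]
    exact fun t ht q hq => if_neg fun h' => hq (h' t ht)
  have hub : star (u N) ⬝ᵥ b = (sqNorm b : ℂ) := by
    rw [ofReal_sqNorm]
    refine Finset.sum_congr rfl fun q _ => ?_
    simp only [hb, Pi.star_apply]
    split_ifs <;> simp
  have hout : sqNorm b - Real.sqrt η * sqNorm (u N) ≤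
      ∑ q, H.outCount (f N) q * ‖v (f N, q)‖ ^ 2 := by
    have h1 := h.sum_outCount hV hS hleg (u N)
    rw [← hvu N le_rfl] at h1
    have h2 := hNo.acceptProb_add_sqNorm_le hbin hub
    change _ ≤ ∑ q, H.outCount (f N) q * ‖slice v (f N) q‖ ^ 2
    rw [h1]
    linarith
  have hlast : sqNorm (u N) ≤ sqNorm v := by
    rw [hnorm]
    exact Finset.single_le_sum (f := fun t => sqNorm (u t)) (fun t _ => sqNorm_nonneg _)
      (Finset.self_mem_range_succ N)
  have hlast' := mul_le_mul_of_nonneg_left hlast (Real.sqrt_nonneg η)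
  have hchain : (1 - Real.cos (Real.pi / (2 * (N + 1)))) * sqNorm v ≤
      ∑ t ∈ Finset.range N, 1 / 2 * sqNorm (u (t + 1) - u t) +
        ∑ t ∈ Finset.range (N + 1), ∑ q, H.inCount (f t) q * ‖u t q‖ ^ 2 + sqNorm b := by
    rw [hnorm]
    simp only [sqNorm, Finset.mul_sum]
    rw [Finset.sum_comm, Finset.sum_comm (s := Finset.range N),
      Finset.sum_comm (s := Finset.range (N + 1)), ← Finset.sum_add_distrib,
      ← Finset.sum_add_distrib]
    refine Finset.sum_le_sum fun q _ => ?_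
    rw [← Finset.mul_sum]
    have hnn : ∀ t ∈ Finset.range (N + 1), 0 ≤ H.inCount (f t) q * ‖u t q‖ ^ 2 :=
      fun t _ => mul_nonneg (H.inCount_nonneg _ _) (sq_nonneg _)
    by_cases hq : ∀ t ≤ N, H.inCount (f t) q = 0
    · -- an input is penalised by the output penalty at the end
      have h1 := le_sum_norm_sub_sq_add (le_refl N) fun t => u t q
      have h2 := Finset.sum_nonneg hnn
      have h3 : ‖b q‖ ^ 2 = ‖u N q‖ ^ 2 := by rw [hb]; simp only [if_pos hq]
      rw [h3]
      simp only [Pi.sub_apply]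
      linarith
    · -- a wrong input is penalised by the input penalty at some time `τ`
      push Not at hq
      obtain ⟨τ, hτ, hqτ⟩ := hq
      have h1 := le_sum_norm_sub_sq_add hτ fun t => u t q
      have h2 := Finset.single_le_sum hnn (Finset.mem_range_succ_iff.2 hτ)
      have h3 := mul_le_mul_of_nonneg_right (one_le_inCount hqτ) (sq_nonneg ‖u τ q‖)
      have h4 := sq_nonneg ‖b q‖
      simp only [Pi.sub_apply]
      linarith
  rw [h.penaltyEnergy_eq hclock hS hleg hv, htrans, Finset.sum_congr rfl hin]
  linarith

end IsTimeline

end LegalCells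

end StandardForm

theorem mainTheorem3 {C Q : Type*} [Fintype C] [DecidableEq C] [Fintype Q] [DecidableEq Q]
    (L Tinit : ℕ) (H : StandardForm C Q) (hclock : H.IsStandardFormClock L Tinit)
    (V : Verifier (Fin L → Q)) (hV : H.Encodes V) (η : ℝ)
    (S : Set (Fin L → C)) (hS : H.IsCell S) :
    ∃ lam : ℝ, IsLeast (H.energies S) lam ∧
      (((∀ k ∈ S, ¬ H.Legal k) ∧ 1 ≤ lam) ∨
       ((∃ k ∈ S, H.Legal k) ∧ (∃ k ∈ S, ¬ H.Legal k) ∧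
          1 - Real.cos (Real.pi / (8 * (L : ℝ))) ≤ lam) ∨
       ((∀ k ∈ S, H.Legal k) ∧
          (V.IsYes η → 0 ≤ lam ∧ lam ≤ Real.sqrt η) ∧
          (V.IsNo η →
            1 - Real.cos (Real.pi / (2 * (S.ncard : ℝ))) - Real.sqrt η ≤ lam ∧
            lam ≤ 1 - Real.cos (Real.pi / (2 * (S.ncard : ℝ)))))) := by
  -- the quantum register is not zero-dimensional, as it holds an input
  obtain ⟨ψ₀, hψ₀, hnorm₀⟩ := V.exists_input
  have : Nonempty (Fin L → Q) := by
    by_contra h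
    rw [not_nonempty_iff] at h
    simp [sqNorm] at hnorm₀
  obtain ⟨lam, hlam, hray⟩ := exists_isLeast_energies hS.1.2 hS.1.1
  refine ⟨lam, hlam, ?_⟩
  by_cases hill : ∃ k ∈ S, ¬ H.Legal k
  · by_cases hleg : ∃ k ∈ S, H.Legal k
    · exact Or.inr (Or.inl ⟨hleg, hill,
        le_of_mem_energies (fun v hv => hclock.le_energy_of_mixed hS hleg hill hv) hlam.1⟩)
    · push Not at hleg
      exact Or.inl ⟨hleg, le_of_mem_energies (fun v hv => one_mul_sqNorm_le_energy hleg hv) hlam.1⟩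
  · push Not at hill
    obtain ⟨N, f, G, h⟩ := hclock.exists_isTimeline hS hill
    refine Or.inr (Or.inr ⟨hill, ?_, fun hNo => ?_⟩)
    · rintro ⟨ψ, hψ, hnorm, hacc⟩
      have h0 : 0 ≤ lam := le_of_mem_energies (fun v _ => by
        rw [zero_mul]
        exact add_nonneg (H.transEnergy_nonneg v) (H.penaltyEnergy_nonneg v)) hlam.1
      obtain ⟨v, hv, hvnorm, hvE⟩ :=
        h.exists_historyState hclock hV hS hill (fun _ => 1) hψ hnorm
      have h1 := hray v hv
      simp only [hvnorm, hvE, sub_self, one_pow, Finset.sum_const, Finset.card_range, nsmul_eq_mul,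
        mul_one, one_mul, Nat.cast_add, Nat.cast_one] at h1
      have h2 : 0 ≤ lam * N := mul_nonneg h0 (Nat.cast_nonneg N)
      have h3 := V.acceptProb_nonneg ψ
      have h4 : lam ≤ 1 := by norm_num at h1; linarith
      -- `lam ≤ 1` and `lam ≤ 1 - acceptProb ψ ≤ η` give `lam ^ 2 ≤ η`, whatever the size of `η`
      refine ⟨h0, Real.le_sqrt_of_sq_le ?_⟩
      norm_num at h1
      nlinarith
    · rw [h.ncard, Nat.cast_add, Nat.cast_one]
      refine ⟨le_of_mem_energies
        (fun v hv => h.le_energy_of_isNo hclock hV hS hill hNo hv) hlam.1, ?_⟩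
      obtain ⟨v, hv, hvnorm, hvE⟩ :=
        h.exists_historyState hclock hV hS hill (chainMode N) hψ₀ hnorm₀
      have h1 := hray v hv
      have h2 : 0 ≤ chainMode N N ^ 2 * V.acceptProb ψ₀ :=
        mul_nonneg (sq_nonneg _) (V.acceptProb_nonneg ψ₀)
      have h3 := sum_chainMode_add_sq N
      rw [hvE, hvnorm] at h1
      refine le_of_mul_le_mul_right (h1.trans ?_)
        (Finset.sum_pos (fun t ht => pow_pos (chainMode_pos (Finset.mem_range_succ_iff.1 ht)) 2)
          (Finset.nonempty_range_add_one))
      linarith
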